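/- **Setting.** Let $n\ge 1$, $m\ge 1$, $0\le \ell\le m-1$ be integers, $p\in(1,\infty)$, $a_j\in\mathbb R$ and $\sigma_j\ge 0$ for $0\le j\le m-1$, and put $a_m=1$, $\sigma_m=0$, $A_j=a_j(-\Delta)^{\sigma_j}$ (with $(-\Delta)^0=\mathrm{Id}$), $L=\sum_{j=0}^m A_j\partial_t^j$. Assume that $\sigma_j\notin\mathbb Z$ for at least one $j\le m-1$ with $a_j\ne0$. Let $[\sigma]$ be the integer part of $\sigma$, $\langle x\rangle=(1+|x|^2)^{1/2}$ and $$ s=\min\{\sigma_j-[\sigma_j]:\ a_j\neq0,\ \sigma_j\notin\mathbb Z\}\in(0,1),\qquad q=n+2s. $$ For non-integer $\sigma>0$, with $k=[\sigma]$ and $\tau_zf(x)=f(x+z)$, $$(-\Delta)^\sigma f(x)=(-1)^{k+1}C\int_{\mathbb R^n}\frac{(\tau_{y/2}-\tau_{-y/2})^{2k+2}f(x)}{|y|^{n+2\sigma}}\,dy,\qquad C=2^{2\sigma-2k-2}\Big(\int_{\mathbb R^n}\frac{\sin(y_1)^{2k+2}}{|y|^{n+2\sigma}}\,dy\Big)^{-1},$$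 which on the functions used below is the Fourier multiplier $|\xi|^{2\sigma}$; for integer $\sigma$ it is the iterate of the classical $-\Delta$. **Critical exponent.** For $\eta\in[0,\infty)$ let $$g(\eta)=\min_{0\le j\le m,\ a_j\ne0}\{(j-\ell)\eta+2\sigma_j\},\qquad h(\eta)=\frac{n+\eta}{(n+\eta-g(\eta))_+}\quad(b_+=\max\{b,0\},\ \text{with value }\infty\text{ if the denominator is }0),$$ $h(\infty)=\lim_{\eta\to\infty}h(\eta)$, and $p_c=\max_{\eta\in[0,\infty]}h(\eta)\in[1,\infty]$. **Weak solutions.** Let $\mathcal C_q^\infty$ be the space of real $\varphi\in C^\infty(\mathbb R^n)$ such that $\langle x\rangle^q\varphi$ is bounded and $\langle x\rangle^q(-\Delta)^\sigma\varphi$ is bounded for every $\sigma>0$ with $\sigma\in\mathbb Z$ or $\sigma-[\sigma]\ge s$. A global-in-time weak solution of $$Lu=|\partial_t^\ell u|^p\ \ (t>0,\ x\in\mathbb R^n),\qquad \partial_t^ju(0,x)=u_j(x)\ \ (0\le j\le m-1),$$ where $u_j=0$ for $j<\ell$, is a real function $u\in W^{\ell,p}_{\rm loc}([0,\infty),L^p(\mathbb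 R^n,\langle x\rangle^{-q}dx))$ such that $\partial_t^ju(0,\cdot)=0$ for $j\le\ell-1$ and, for every $\psi\in C_c^\infty([0,\infty))$ with $\psi=1$ near $0$ and every $\varphi\in\mathcal C_q^\infty$, $$\int_0^\infty\!\psi\int_{\mathbb R^n}|\partial_t^\ell u|^p\varphi\,dx\,dt=\sum_{j=0}^m(-1)^{j-\ell}\int_0^\infty\!\psi^{(j-\ell)}\int_{\mathbb R^n}\partial_t^\ell u\,A_j\varphi\,dx\,dt-\sum_{j=\ell}^{m-1}\int_{\mathbb R^n}u_jA_{j+1}\varphi\,dx,$$ where for $i<0$ the function $\psi^{(i)}(t)=-\int_t^\infty\psi^{(i+1)}(\tau)\,d\tau$ is the compactly supported primitive of $\psi^{(i+1)}$. **Theorem.** Let $I=\{j:\ \ell\le j\le m-1,\ \sigma_{j+1}=0,\ a_{j+1}\ne0\}$. Assume that the real initial data satisfy $u_j=0$ for $j\le\ell-1$, $u_j\in L^1(\mathbb R^n,\langle x\rangle^q dx)$ for $\ell\le j\le m-1$ with $j\notin I$, $u_j\in L^1(\mathbb R^n)$ for $j\in I$, and $$\sum_{j\in I}a_{j+1}\int_{\mathbb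 R^n}u_j(x)\,dx>0.$$ If a global-in-time weak solution exists, then $p>p_c$. (In particular, there is none if $1<p\le p_c$, and none for any $p>1$ if $p_c=\infty$.) -/

import Mathlib

open MeasureTheory Filter Topology
open scoped ENNReal

noncomputable section

namespace FracEvolution

/-- `⟨x⟩ = (1 + |x|²)^{1/2}`. -/
def japanese {n : ℕ} (x : EuclideanSpace ℝ (Fin n)) : ℝ := Real.sqrt (1 + ‖x‖ ^ 2)

/-! ### The (fractional) Laplacian -/

/-- The central difference `(τ_{y/2} - τ_{-y/2}) f`, where `τ_z f (x) = f (x + z)`. -/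
def centralDiff {n : ℕ} (y : EuclideanSpace ℝ (Fin n)) (f : EuclideanSpace ℝ (Fin n) → ℝ) :
    EuclideanSpace ℝ (Fin n) → ℝ :=
  fun x => f (x + (1 / 2 : ℝ) • y) - f (x - (1 / 2 : ℝ) • y)

/-- The normalising constant `2^{2σ-2k-2} (∫ sin(y₁)^{2k+2} / |y|^{n+2σ} dy)⁻¹`, `k = [σ]`,
which makes the singular integral below the Fourier multiplier `|ξ|^{2σ}`. -/
def fracConst (n : ℕ) [NeZero n] (σ : ℝ) : ℝ :=
  (2 : ℝ) ^ (2 * σ - 2 * (⌊σ⌋₊ : ℝ) - 2) *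
    (∫ y : EuclideanSpace ℝ (Fin n),
      Real.sin (y 0) ^ (2 * ⌊σ⌋₊ + 2) / ‖y‖ ^ ((n : ℝ) + 2 * σ))⁻¹

/-- `(-Δ)^σ f` for `σ ≥ 0`: the iterated classical operator `-Δ` if `σ` is an integer (the
identity if `σ = 0`), and otherwise
`(-1)^{[σ]+1} C ∫ (τ_{y/2} - τ_{-y/2})^{2[σ]+2} f(x) |y|^{-n-2σ} dy`.
For smooth `f` with bounded derivatives the integral converges absolutely; if moreover
all derivatives of `f` are square integrable it agrees with the Fourier multiplier
`|ξ|^{2σ}`. -/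
def fracLap {n : ℕ} [NeZero n] (σ : ℝ) (f : EuclideanSpace ℝ (Fin n) → ℝ) :
    EuclideanSpace ℝ (Fin n) → ℝ :=
  open Classical in
  if Int.fract σ = 0 then
    (fun h : EuclideanSpace ℝ (Fin n) → ℝ => fun x => -(Laplacian.laplacian h x))^[⌊σ⌋₊] f
  else
    fun x => (-1 : ℝ) ^ (⌊σ⌋₊ + 1) * fracConst n σ *
      ∫ y : EuclideanSpace ℝ (Fin n),
        (centralDiff y)^[2 * ⌊σ⌋₊ + 2] f x / ‖y‖ ^ ((n : ℝ) + 2 * σ)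

/-- The test function space `C_q^∞(ℝⁿ)`, `q = n + 2s`: smooth `φ` such that `⟨x⟩^q φ` is bounded
and `⟨x⟩^q (-Δ)^σ φ` is bounded for every `σ > 0` that is an integer or has fractional part
at least `s`. -/
structure IsTestFunction {n : ℕ} [NeZero n] (s : ℝ) (φ : EuclideanSpace ℝ (Fin n) → ℝ) :
    Prop where
  smooth : ContDiff ℝ ((⊤ : ℕ∞) : WithTop ℕ∞) φ
  decay : ∃ C : ℝ, ∀ x, japanese x ^ ((n : ℝ) + 2 * s) * |φ x| ≤ C
  decay_fracLap : ∀ σ : ℝ, 0 < σ → (Int.fract σ = 0 ∨ s ≤ Int.fract σ) →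
    ∃ C : ℝ, ∀ x, japanese x ^ ((n : ℝ) + 2 * s) * |fracLap σ φ x| ≤ C

/-! ### Test functions in time -/

/-- `ψ ∈ C_c^∞([0,∞))` with `ψ = 1` near `0`. Only the values of `ψ` on `[0,∞)` matter
below. -/
structure IsTimeTest (ψ : ℝ → ℝ) : Prop where
  smooth : ContDiff ℝ ((⊤ : ℕ∞) : WithTop ℕ∞) ψ
  compact : ∃ M : ℝ, ∀ t, M ≤ t → ψ t = 0
  one_near_zero : ∀ᶠ t in 𝓝[≥] (0 : ℝ), ψ t = 1

/-- The primitive `t ↦ -∫_t^∞ f` vanishing at infinity. -/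
def tailPrimitive (f : ℝ → ℝ) : ℝ → ℝ := fun t => -∫ τ in Set.Ioi t, f τ

/-- `ψ^{(k)}` for an integer `k`: the `k`-th derivative if `k ≥ 0`, the `|k|`-fold compactly
supported primitive if `k < 0`. -/
def timeDeriv (ψ : ℝ → ℝ) : ℤ → ℝ → ℝ
  | Int.ofNat k => iteratedDeriv k ψ
  | Int.negSucc k => tailPrimitive^[k + 1] ψ

/-! ### Time-dependent functions with values in a weighted Lebesgue space -/

/-- The measure `⟨x⟩^r dx` on `ℝⁿ`. -/
def weightedVolume (n : ℕ) (r : ℝ) : Measure (EuclideanSpace ℝ (Fin n)) :=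
  volume.withDensity (fun x => ENNReal.ofReal (japanese x ^ r))

/-- The Lebesgue space `L^p(ℝⁿ, ⟨x⟩^r dx)` of real functions. -/
abbrev WeightedLp (n : ℕ) (p r : ℝ) : Type :=
  Lp ℝ (ENNReal.ofReal p) (weightedVolume n r)

instance factOneLe (p : ℝ) [h : Fact (1 < p)] : Fact (1 ≤ ENNReal.ofReal p) :=
  ⟨ENNReal.one_le_ofReal.2 h.out.le⟩

/-- `f ∈ L^p_loc([0,∞), X)`. -/
def MemLpLoc {X : Type*} [NormedAddCommGroup X] (p : ℝ) (f : ℝ → X) : Prop :=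
  ∀ T : ℝ, MemLp f (ENNReal.ofReal p) (volume.restrict (Set.Icc 0 T))

/-- `g` is the `k`-th weak derivative of `f` on `(0,∞)`:
`∫ θ^{(k)} f dt = (-1)^k ∫ θ g dt` for all `θ ∈ C_c^∞((0,∞))`. -/
def IsWeakTimeDeriv {X : Type*} [NormedAddCommGroup X] [NormedSpace ℝ X]
    (k : ℕ) (f g : ℝ → X) : Prop :=
  ∀ θ : ℝ → ℝ, ContDiff ℝ ((⊤ : ℕ∞) : WithTop ℕ∞) θ → HasCompactSupport θ →
    tsupport θ ⊆ Set.Ioi 0 →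
    ∫ t in Set.Ioi (0 : ℝ), iteratedDeriv k θ t • f t =
      (-1 : ℝ) ^ k • ∫ t in Set.Ioi (0 : ℝ), θ t • g t

/-- `f ∈ W^{ℓ,p}_loc([0,∞), X)`. -/
def MemSobolevLoc {X : Type*} [NormedAddCommGroup X] [NormedSpace ℝ X]
    (ℓ : ℕ) (p : ℝ) (f : ℝ → X) : Prop :=
  MemLpLoc p f ∧ ∀ k, 1 ≤ k → k ≤ ℓ → ∃ g : ℝ → X, MemLpLoc p g ∧ IsWeakTimeDeriv k f g

/-- The `k`-th weak time derivative of `f` has a representative that is continuous on `[0,∞)`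
and vanishes at `t = 0`. -/
def TraceZero {X : Type*} [NormedAddCommGroup X] [NormedSpace ℝ X]
    (k : ℕ) (f : ℝ → X) : Prop :=
  ∃ w : ℝ → X, ContinuousOn w (Set.Ici 0) ∧ IsWeakTimeDeriv k f w ∧ w 0 = 0

/-! ### Weak solutions -/

/-- `u` is a global-in-time weak solution of `L u = |∂_t^ℓ u|^p`, `∂_t^j u(0,·) = u_j`
(`j = 0, …, m-1`), where `L = ∑_{j=0}^m a_j (-Δ)^{σ_j} ∂_t^j` and `data j = u_j`.
Here `q = n + 2s`. -/
structure IsGlobalWeakSolution {n : ℕ} [NeZero n] (m ℓ : ℕ) (a σ : ℕ → ℝ) (s p : ℝ)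
    [Fact (1 < p)] (data : ℕ → EuclideanSpace ℝ (Fin n) → ℝ)
    (u : ℝ → WeightedLp n p (-((n : ℝ) + 2 * s))) : Prop where
  sobolev : MemSobolevLoc ℓ p u
  initial : ∀ j < ℓ, TraceZero j u
  equation : ∀ v : ℝ → WeightedLp n p (-((n : ℝ) + 2 * s)),
    MemLpLoc p v → IsWeakTimeDeriv ℓ u v →
    ∀ ψ : ℝ → ℝ, IsTimeTest ψ →
    ∀ φ : EuclideanSpace ℝ (Fin n) → ℝ, IsTestFunction s φ →
      (∫ t in Set.Ioi (0 : ℝ), ψ t * (∫ x, |v t x| ^ p * φ x)) =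
        (∑ j ∈ Finset.range (m + 1), (-1 : ℝ) ^ ((j : ℤ) - (ℓ : ℤ)) *
            (∫ t in Set.Ioi (0 : ℝ), timeDeriv ψ ((j : ℤ) - (ℓ : ℤ)) t *
              (∫ x, v t x * (a j * fracLap (σ j) φ x))))
          - (∑ j ∈ Finset.Ico ℓ m,
              (∫ x, data j x * (a (j + 1) * fracLap (σ (j + 1)) φ x)))

/-! ### The critical exponent -/

/-- `g(η) = min { (j-ℓ) η + 2 σ_j : 0 ≤ j ≤ m, a_j ≠ 0 }` (a minimum over a finite set, which
contains `j = m` when `a_m = 1`). -/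
def scalingFn (m ℓ : ℕ) (a σ : ℕ → ℝ) (η : ℝ) : ℝ :=
  sInf ((fun j : ℕ => ((j : ℝ) - (ℓ : ℝ)) * η + 2 * σ j) '' {j | j ≤ m ∧ a j ≠ 0})

/-- `h(η) = (n+η) / (n+η-g(η))_+` for finite `η`, with value `∞` if the denominator is `0`. -/
def hFin (n m ℓ : ℕ) (a σ : ℕ → ℝ) (η : ℝ) : ℝ≥0∞ :=
  ENNReal.ofReal ((n : ℝ) + η) / ENNReal.ofReal ((n : ℝ) + η - scalingFn m ℓ a σ η)

/-- `h` on `[0,∞]`, with `h(∞) = lim_{η → ∞} h(η)`. The limit always exists in `[0,∞]`, as `g`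
is eventually affine, so it is written as an upper limit. -/
def hExt (n m ℓ : ℕ) (a σ : ℕ → ℝ) (η : ℝ≥0∞) : ℝ≥0∞ :=
  open Classical in
  if η = ⊤ then limsup (hFin n m ℓ a σ) atTop else hFin n m ℓ a σ η.toReal

/-- The critical exponent `p_c = max_{η ∈ [0,∞]} h(η) ∈ [1,∞]`. -/
def critExp (n m ℓ : ℕ) (a σ : ℕ → ℝ) : ℝ≥0∞ := ⨆ η : ℝ≥0∞, hExt n m ℓ a σ η

/-- `I = { j ≥ ℓ : σ_{j+1} = 0, a_{j+1} ≠ 0 }`, where `j ≤ m-1`. -/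
def signSet (m ℓ : ℕ) (a σ : ℕ → ℝ) : Finset ℕ :=
  open Classical in
  (Finset.Ico ℓ m).filter (fun j => σ (j + 1) = 0 ∧ a (j + 1) ≠ 0)

end FracEvolution

end

/-!
# Nonexistence of global weak solutions up to the critical exponent

The proof is a test function argument with `φ_R(x) = ⟨x / R⟩^{-q}`, `q = n + 2s`, in space and
`ψ(t / R^η)` in time, where `ψ` is a large power of a smooth step.

The function `⟨x⟩^{-q}` dominates all its admissible fractional Laplacians
(`exists_abs_fracLap_bracketPow_le`). For integer orders this holds since `-Δ` maps `⟨x⟩^{-r}` to a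
combination of `⟨x⟩^{-r-2}` and `⟨x⟩^{-r-4}`. For a non-integer order `σ`, the central differences
in the singular integral gain a power of `|y|` for `|y| ≤ 1`, while for `|y| ≥ 1` one has
`⟨x + c y⟩^{-q} |y|^{-n-2σ} ≲ ⟨x⟩^{-q} (⟨y⟩^{-q} + ⟨x + c y⟩^{-q})`, because `σ ≥ s`.
By homogeneity, `|(-Δ)^σ φ_R| ≤ C R^{-2σ} φ_R`. Likewise `|ψ^{(k)}| ≤ C ψ^{1/p}`
(`exists_timeCutoff`).

Let `H_R(t) = ψ(t / R^η) ∫ |∂_t^ℓ u|^p φ_R dx`. Hölder's inequality in space bounds the `j`-th term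
of the weak formulation by a multiple of `R^{-2σ_j - (j-ℓ)η + n(1-1/p)} ∫ H_R^{1/p} dt`
(`exists_abs_term_le`), and the data terms converge to `∑_{j ∈ I} a_{j+1} ∫ u_j > 0`
(`tendsto_data_sum`). If `p ≤ h(η)`, i.e. `(n + η)(1 - 1/p) ≤ g(η)`, this gives, for some `ε > 0`
and all large `R`,
`∫ H_R dt + ε ≤ C R^{-η(1-1/p)} ∫ H_R^{1/p} dt`.
By Hölder's inequality in time `∫ H_R` stays bounded; as `H_R` increases with `R`, its tails are
then uniformly small, and since `R^η → ∞` the right-hand side tends to `0`, a contradiction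
(`false_of_integral_add_le`). The subcritical and the critical case are thus treated alike.

Hence `h(η) < p` for all finite `η ≥ 0`. If `a_j = 0` for all `j ≤ ℓ`, then `g(η) ≥ η` and `h` is
unbounded, which is impossible; otherwise `g` is bounded above and `h` stays away from `p` near
infinity, so that the supremum over `[0, ∞]` is less than `p` by compactness (`critExp_lt`).
-/

noncomputable section

namespace FracEvolution

/-! ### Powers of the Japanese bracket -/

/-- The function `⟨x⟩^{-r}`. -/
def bracketPow {n : ℕ} (r : ℝ) (x : EuclideanSpace ℝ (Fin n)) : ℝ := japanese x ^ (-r)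

section Bracket

variable {n : ℕ}

lemma one_le_japanese (x : EuclideanSpace ℝ (Fin n)) : 1 ≤ japanese x := by
  rw [japanese, Real.one_le_sqrt]
  nlinarith [sq_nonneg ‖x‖]

lemma japanese_pos (x : EuclideanSpace ℝ (Fin n)) : 0 < japanese x :=
  lt_of_lt_of_le one_pos (one_le_japanese x)

lemma japanese_sq (x : EuclideanSpace ℝ (Fin n)) : japanese x ^ 2 = 1 + ‖x‖ ^ 2 :=
  Real.sq_sqrt (by positivity)

lemma norm_le_japanese (x : EuclideanSpace ℝ (Fin n)) : ‖x‖ ≤ japanese x :=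
  Real.le_sqrt_of_sq_le (by linarith)

lemma japanese_le_of_norm_le {x y : EuclideanSpace ℝ (Fin n)} {c : ℝ} (hc : 1 ≤ c)
    (h : ‖x‖ ≤ c * ‖y‖) : japanese x ≤ c * japanese y := by
  refine abs_le_of_sq_le_sq' ?_ (by have := japanese_pos y; positivity) |>.2
  rw [mul_pow, japanese_sq, japanese_sq]
  have := pow_le_pow_left₀ (norm_nonneg x) h 2
  nlinarith

lemma japanese_le_two_mul {x z : EuclideanSpace ℝ (Fin n)} (hz : ‖z‖ ≤ 1) :
    japanese x ≤ 2 * japanese (x + z) := by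
  refine abs_le_of_sq_le_sq' ?_ (by have := japanese_pos (x + z); positivity) |>.2
  rw [mul_pow, japanese_sq, japanese_sq]
  have h : ‖x‖ ≤ ‖x + z‖ + ‖z‖ := by simpa using norm_sub_le (x + z) z
  have h2 := pow_le_pow_left₀ (norm_nonneg x) h 2
  nlinarith [sq_nonneg (‖x + z‖ - ‖z‖), norm_nonneg z]

lemma bracketPow_eq (r : ℝ) (x : EuclideanSpace ℝ (Fin n)) :
    bracketPow r x = (1 + ‖x‖ ^ 2) ^ (-r / 2) := by
  rw [bracketPow, japanese, Real.sqrt_eq_rpow, ← Real.rpow_mul (by positivity)]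
  congr 1; ring

lemma bracketPow_pos (r : ℝ) (x : EuclideanSpace ℝ (Fin n)) : 0 < bracketPow r x :=
  Real.rpow_pos_of_pos (japanese_pos x) _

lemma bracketPow_le_one {r : ℝ} (hr : 0 ≤ r) (x : EuclideanSpace ℝ (Fin n)) :
    bracketPow r x ≤ 1 :=
  Real.rpow_le_one_of_one_le_of_nonpos (one_le_japanese x) (by linarith)

lemma bracketPow_zero_right (r : ℝ) : bracketPow r (0 : EuclideanSpace ℝ (Fin n)) = 1 := by
  simp [bracketPow, japanese]

lemma bracketPow_anti {r r' : ℝ} (h : r ≤ r') (x : EuclideanSpace ℝ (Fin n)) :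
    bracketPow r' x ≤ bracketPow r x :=
  Real.rpow_le_rpow_of_exponent_le (one_le_japanese x) (by linarith)

lemma contDiff_bracketPow (r : ℝ) :
    ContDiff ℝ ((⊤ : ℕ∞) : WithTop ℕ∞) (bracketPow (n := n) r) := by
  have : bracketPow (n := n) r = fun x => (1 + ‖x‖ ^ 2) ^ (-r / 2) := funext (bracketPow_eq r)
  rw [this]
  refine ContDiff.rpow_const_of_ne ?_ fun x => by positivity
  exact contDiff_const.add (contDiff_norm_sq ℝ)

lemma continuous_bracketPow (r : ℝ) : Continuous (bracketPow (n := n) r) :=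
  (contDiff_bracketPow r).continuous

lemma integrable_bracketPow {r : ℝ} (hr : (n : ℝ) < r) : Integrable (bracketPow (n := n) r) := by
  have := integrable_rpow_neg_one_add_norm_sq (E := EuclideanSpace ℝ (Fin n)) (μ := volume)
    (r := r) (by simpa using hr)
  exact this.congr (Eventually.of_forall fun x => (bracketPow_eq r x).symm)

lemma bracketPow_le_of_japanese_le {r c : ℝ} (hr : 0 ≤ r) (hc : 0 < c)
    {x y : EuclideanSpace ℝ (Fin n)} (h : japanese x ≤ c * japanese y) :
    bracketPow r y ≤ c ^ r * bracketPow r x := by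
  have hx := japanese_pos x
  have hy := japanese_pos y
  have h1 : (c * japanese y) ^ (-r) ≤ japanese x ^ (-r) :=
    Real.rpow_le_rpow_of_nonpos hx h (by linarith)
  rw [Real.mul_rpow hc.le hy.le] at h1
  calc bracketPow r y = c ^ r * (c ^ (-r) * japanese y ^ (-r)) := by
        rw [← mul_assoc, ← Real.rpow_add hc]; simp [bracketPow]
    _ ≤ c ^ r * bracketPow r x := by unfold bracketPow; gcongr

lemma hasFDerivAt_bracketPow (r : ℝ) (x : EuclideanSpace ℝ (Fin n)) :
    HasFDerivAt (bracketPow (n := n) r) ((-r * bracketPow (r + 2) x) • innerSL ℝ x) x := by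
  have h0 : (1 + ‖x‖ ^ 2 : ℝ) ≠ 0 := by positivity
  have h1 : HasFDerivAt (fun x : EuclideanSpace ℝ (Fin n) => 1 + ‖x‖ ^ 2)
      (2 • (innerSL ℝ x)) x :=
    (hasStrictFDerivAt_norm_sq x).hasFDerivAt.const_add 1
  have h2 := h1.rpow_const (p := -r / 2) (Or.inl h0)
  have h3 : bracketPow (n := n) r = fun x => (1 + ‖x‖ ^ 2) ^ (-r / 2) := funext (bracketPow_eq r)
  rw [h3]
  refine h2.congr_fderiv ?_
  rw [bracketPow_eq, show -(r + 2) / 2 = -r / 2 - 1 by ring, ← Nat.cast_smul_eq_nsmul ℝ, smul_smul]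
  congr 1
  push_cast
  ring

end Bracket

/-! ### Central differences of bracket powers -/

section CentralDiff

variable {n : ℕ}

lemma centralDiff_iterate_eq (y : EuclideanSpace ℝ (Fin n)) (N : ℕ)
    (f : EuclideanSpace ℝ (Fin n) → ℝ) (x : EuclideanSpace ℝ (Fin n)) :
    (centralDiff y)^[N] f x = (fwdDiff y)^[N] f (x - ((N : ℝ) / 2) • y) := by
  induction N generalizing x with
  | zero => simp
  | succ N ih =>
    rw [Function.iterate_succ_apply', Function.iterate_succ_apply', centralDiff, ih, ih, fwdDiff]
    congr 2
    · exact congrArg _ (by push_cast; module)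
    · exact congrArg _ (by push_cast; module)

lemma centralDiff_iterate_comp_smul (c : ℝ) (y : EuclideanSpace ℝ (Fin n)) (N : ℕ)
    (f : EuclideanSpace ℝ (Fin n) → ℝ) (x : EuclideanSpace ℝ (Fin n)) :
    (centralDiff y)^[N] (fun z => f (c • z)) x = (centralDiff (c • y))^[N] f (c • x) := by
  induction N generalizing x with
  | zero => simp
  | succ N ih =>
    rw [Function.iterate_succ_apply', Function.iterate_succ_apply', centralDiff, centralDiff,
      ih, ih]
    congr 2
    · exact congrArg _ (by module)
    · exact congrArg _ (by module)

lemma centralDiff_iterate_linear (y : EuclideanSpace ℝ (Fin n)) (N : ℕ) (a b : ℝ)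
    (f g : EuclideanSpace ℝ (Fin n) → ℝ) (x : EuclideanSpace ℝ (Fin n)) :
    (centralDiff y)^[N] (fun z => a * f z + b * g z) x =
      a * (centralDiff y)^[N] f x + b * (centralDiff y)^[N] g x := by
  induction N generalizing x with
  | zero => simp
  | succ N ih =>
    simp only [Function.iterate_succ_apply', centralDiff, ih]
    ring

lemma hasLineDerivAt_centralDiff_iterate (y : EuclideanSpace ℝ (Fin n)) (N : ℕ)
    {f f' : EuclideanSpace ℝ (Fin n) → ℝ} (h : ∀ x, HasLineDerivAt ℝ f (f' x) x y)
    (x : EuclideanSpace ℝ (Fin n)) :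
    HasLineDerivAt ℝ ((centralDiff y)^[N] f) ((centralDiff y)^[N] f' x) x y := by
  induction N generalizing x with
  | zero => exact h x
  | succ N ih =>
    simp only [Function.iterate_succ_apply']
    have h1 := (ih (x + (1 / 2 : ℝ) • y)).sub (ih (x - (1 / 2 : ℝ) • y))
    refine HasDerivAt.congr_of_eventuallyEq h1 (Eventually.of_forall fun t => ?_)
    simp only [centralDiff, Pi.sub_apply]
    congr 2
    · exact congrArg _ (by module)
    · exact congrArg _ (by module)

lemma hasLineDerivAt_inner_pow_mul_bracketPow (i : ℕ) (r : ℝ) (x y : EuclideanSpace ℝ (Fin n)) :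
    HasLineDerivAt ℝ (fun z => inner ℝ z y ^ i * bracketPow r z)
      ((i * ‖y‖ ^ 2) * (inner ℝ x y ^ (i - 1) * bracketPow r x)
        + (-r) * (inner ℝ x y ^ (i + 1) * bracketPow (r + 2) x)) x y := by
  have h1 : HasFDerivAt (fun z : EuclideanSpace ℝ (Fin n) => inner ℝ z y) (innerSL ℝ y) x := by
    refine (innerSL ℝ y).hasFDerivAt.congr_of_eventuallyEq (Eventually.of_forall fun z => ?_)
    simp [real_inner_comm]
  have h2 := ((h1.pow i).mul (hasFDerivAt_bracketPow r x)).hasLineDerivAt y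
  refine HasDerivAt.congr_deriv h2 ?_
  simp
  ring

/-- Central differences of order `N` with a step `|y| ≤ 1` gain a factor `|y|^N` and preserve the
decay of bracket powers. The family `⟨x, y⟩^i ⟨x⟩^{-r}` is closed under differentiation in the
direction `y`, which makes an induction on `N` possible. -/
lemma exists_abs_centralDiff_iterate_le {q : ℝ} (hq : 0 ≤ q) (N : ℕ) :
    ∀ (i : ℕ) (r : ℝ), q + i ≤ r → ∃ C : ℝ, 0 ≤ C ∧
      ∀ x y : EuclideanSpace ℝ (Fin n), ‖y‖ ≤ 1 →
        |(centralDiff y)^[N] (fun z => inner ℝ z y ^ i * bracketPow r z) x|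
          ≤ C * ‖y‖ ^ (N + i) * bracketPow q x := by
  induction N with
  | zero =>
    intro i r hr
    refine ⟨1, zero_le_one, fun x y _ => ?_⟩
    simp only [Function.iterate_zero, id, zero_add, one_mul]
    rw [abs_mul, abs_of_pos (bracketPow_pos r x), abs_pow]
    have hx := japanese_pos x
    calc |inner ℝ x y| ^ i * bracketPow r x ≤ (japanese x * ‖y‖) ^ i * bracketPow r x := by
          have := (bracketPow_pos r x).le
          gcongr
          exact (abs_real_inner_le_norm x y).trans (by gcongr; exact norm_le_japanese x)
      _ = ‖y‖ ^ i * bracketPow (r - i) x := by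
          rw [mul_pow, bracketPow, bracketPow, show -(r - i) = (i : ℝ) + -r by ring,
            Real.rpow_add hx, Real.rpow_natCast]
          ring
      _ ≤ _ := by
          gcongr
          exact bracketPow_anti (by linarith) x
  | succ N ih =>
    intro i r hr
    obtain ⟨C₂, hC₂, h₂⟩ := ih (i + 1) (r + 2) (by push_cast; linarith)
    obtain ⟨C₁, hC₁, h₁⟩ := ih (i - 1) r (by
      have : ((i - 1 : ℕ) : ℝ) ≤ i := by exact_mod_cast Nat.sub_le i 1
      linarith)
    refine ⟨(i * C₁ + |r| * C₂) * 2 ^ q, by positivity, fun x y hy => ?_⟩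
    set g : EuclideanSpace ℝ (Fin n) → ℝ := fun z => inner ℝ z y ^ i * bracketPow r z
    set G := (centralDiff y)^[N] g with hG
    set G' : EuclideanSpace ℝ (Fin n) → ℝ := fun z =>
      (i * ‖y‖ ^ 2) * (centralDiff y)^[N] (fun z => inner ℝ z y ^ (i - 1) * bracketPow r z) z
        + (-r) * (centralDiff y)^[N] (fun z => inner ℝ z y ^ (i + 1) * bracketPow (r + 2) z) z
      with hG'
    have hd : ∀ z, HasLineDerivAt ℝ G (G' z) z y := fun z => by
      simp only [hG', ← centralDiff_iterate_linear]
      exact hasLineDerivAt_centralDiff_iterate y N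
        (fun x => hasLineDerivAt_inner_pow_mul_bracketPow i r x y) z
    have hb : ∀ z, |G' z| ≤ (i * C₁ + |r| * C₂) * ‖y‖ ^ (N + 1 + i) * bracketPow q z := fun z => by
      have e₂ := h₂ z y hy
      have e₁ := h₁ z y hy
      have e₃ : |(i * ‖y‖ ^ 2) *
          (centralDiff y)^[N] (fun z => inner ℝ z y ^ (i - 1) * bracketPow r z) z| ≤
          i * C₁ * ‖y‖ ^ (N + 1 + i) * bracketPow q z := by
        rcases Nat.eq_zero_or_pos i with h0 | h0
        · simp [h0]
        · rw [abs_mul, abs_of_nonneg (by positivity)]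
          calc _ ≤ (i * ‖y‖ ^ 2) * (C₁ * ‖y‖ ^ (N + (i - 1)) * bracketPow q z) := by gcongr
            _ = _ := by
              rw [show N + 1 + i = 2 + (N + (i - 1)) by omega, pow_add _ 2]; ring
      refine (abs_add_le _ _).trans ((add_le_add e₃ ?_).trans_eq
        (show _ + |r| * (C₂ * ‖y‖ ^ (N + (i + 1)) * bracketPow q z) = _ by
          rw [show N + (i + 1) = N + 1 + i by ring]; ring))
      rw [abs_mul, abs_neg]
      gcongr
    have hder : ∀ t ∈ Set.Icc (-(1 / 2) : ℝ) (1 / 2),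
        HasDerivWithinAt (fun t : ℝ => G (x + t • y)) (G' (x + t • y))
          (Set.Icc (-(1 / 2) : ℝ) (1 / 2)) t := fun t _ => by
      have h := hd (x + t • y)
      have h' : HasDerivAt (fun τ : ℝ => G (x + t • y + τ • y)) (G' (x + t • y)) (t - t) := by
        rw [sub_self]; exact h
      have := h'.comp_sub_const t t
      refine HasDerivAt.hasDerivWithinAt ?_
      convert this using 3
      module
    have hbd : ∀ t ∈ Set.Icc (-(1 / 2) : ℝ) (1 / 2), ‖G' (x + t • y)‖ ≤
        (i * C₁ + |r| * C₂) * ‖y‖ ^ (N + 1 + i) * (2 ^ q * bracketPow q x) := fun t ht => by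
      refine (hb _).trans ?_
      gcongr
      refine bracketPow_le_of_japanese_le hq two_pos (japanese_le_two_mul ?_)
      rw [norm_smul, Real.norm_eq_abs]
      have : |t| ≤ 1 / 2 := abs_le.2 ht
      nlinarith [norm_nonneg y, abs_nonneg t]
    have hmv := Convex.norm_image_sub_le_of_norm_hasDerivWithin_le hder hbd
      (convex_Icc _ _) (x := -(1 / 2)) (y := 1 / 2) (by norm_num) (by norm_num)
    rw [Function.iterate_succ_apply', ← hG, centralDiff]
    rw [neg_smul, ← sub_eq_add_neg] at hmv
    refine hmv.trans_eq ?_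
    norm_num
    ring

end CentralDiff

/-! ### The fractional Laplacian of a bracket power: non-integer exponents -/

section NonInteger

variable {n : ℕ}

/-- The part of the singular integral near `y = 0` converges because the central difference
vanishes there to order `N > 2σ`. -/
lemma integrable_indicator_closedBall_pow_div_rpow [NeZero n] {N : ℕ} {σ : ℝ}
    (hN : 2 * σ < N) :
    Integrable fun y : EuclideanSpace ℝ (Fin n) =>
      if ‖y‖ ≤ 1 then ‖y‖ ^ N / ‖y‖ ^ ((n : ℝ) + 2 * σ) else 0 := by
  have hn : 0 < n := Nat.pos_of_ne_zero (NeZero.ne n)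
  have : Nontrivial (EuclideanSpace ℝ (Fin n)) :=
    Module.nontrivial_of_finrank_pos (R := ℝ) (by simpa using hn)
  rw [integrable_fun_norm_addHaar (volume : Measure (EuclideanSpace ℝ (Fin n)))
    (f := fun t : ℝ => if t ≤ 1 then t ^ N / t ^ ((n : ℝ) + 2 * σ) else 0)]
  have h1 : IntegrableOn (fun t : ℝ => t ^ ((N : ℝ) - 1 - 2 * σ)) (Set.Ioc 0 1) := by
    have := intervalIntegral.intervalIntegrable_rpow' (a := 0) (b := 1)
      (r := (N : ℝ) - 1 - 2 * σ) (by linarith)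
    rwa [intervalIntegrable_iff_integrableOn_Ioc_of_le zero_le_one] at this
  have h2 : IntegrableOn ((Set.Ioc (0 : ℝ) 1).indicator
      fun t : ℝ => t ^ ((N : ℝ) - 1 - 2 * σ)) (Set.Ioi 0) :=
    (h1.integrable_indicator measurableSet_Ioc).integrableOn
  refine h2.congr_fun (fun t ht => ?_) measurableSet_Ioi
  have ht : 0 < t := ht
  by_cases h : t ≤ 1
  · rw [Set.indicator_of_mem (Set.mem_Ioc.2 ⟨ht, h⟩)]
    simp only [h, if_true, smul_eq_mul, finrank_euclideanSpace, Fintype.card_fin]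
    rw [← Real.rpow_natCast, ← Real.rpow_natCast, ← Real.rpow_sub ht, ← Real.rpow_add ht]
    congr 1
    push_cast [Nat.cast_sub hn]
    ring
  · rw [Set.indicator_of_notMem (by simp [h])]
    simp [h]

/-- Far from `y = 0`, either `|x + c y|` is comparable with `|x|` or `|y|` dominates `|x|`; in both
cases a factor `⟨x⟩^{-q}` splits off. -/
lemma exists_bracketPow_add_smul_div_le {s σ : ℝ} (hs : 0 < s) (hσ : s ≤ σ) (c : ℝ) :
    ∃ K : ℝ, 0 ≤ K ∧ ∀ x y : EuclideanSpace ℝ (Fin n), 1 < ‖y‖ →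
      bracketPow ((n : ℝ) + 2 * s) (x + c • y) / ‖y‖ ^ ((n : ℝ) + 2 * σ) ≤
        K * bracketPow ((n : ℝ) + 2 * s) x * (bracketPow ((n : ℝ) + 2 * s) y +
          if c = 0 then 0 else bracketPow ((n : ℝ) + 2 * s) (x + c • y)) := by
  set q : ℝ := (n : ℝ) + 2 * s
  have hq : 0 ≤ q := by positivity
  refine ⟨2 ^ q * (2 ^ q + (1 + 2 * |c|) ^ q), by positivity, fun x y hy => ?_⟩
  have px := bracketPow_pos q x
  have py := bracketPow_pos q y
  have pc := bracketPow_pos q (x + c • y)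
  have hy0 : 0 < ‖y‖ := by linarith
  have h1 : (‖y‖ ^ ((n : ℝ) + 2 * σ))⁻¹ ≤ 2 ^ q * bracketPow q y := by
    have hj : japanese y ≤ 2 * ‖y‖ := by
      refine abs_le_of_sq_le_sq' ?_ (by positivity) |>.2
      rw [japanese_sq]; nlinarith
    calc (‖y‖ ^ ((n : ℝ) + 2 * σ))⁻¹ = ‖y‖ ^ (-((n : ℝ) + 2 * σ)) := by
          rw [Real.rpow_neg hy0.le]
      _ ≤ ‖y‖ ^ (-q) := Real.rpow_le_rpow_of_exponent_le hy.le (by simp only [q]; linarith)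
      _ = 2 ^ q * (2 * ‖y‖) ^ (-q) := by
          rw [Real.mul_rpow two_pos.le hy0.le, ← mul_assoc, ← Real.rpow_add two_pos]
          simp
      _ ≤ 2 ^ q * bracketPow q y := by
          gcongr
          exact Real.rpow_le_rpow_of_nonpos (japanese_pos y) hj (by linarith)
  have hite : 0 ≤ if c = 0 then 0 else bracketPow q (x + c • y) := by split_ifs <;> linarith
  rw [div_eq_mul_inv]
  by_cases hx : ‖x‖ ≤ 2 * ‖x + c • y‖
  · have h2 : bracketPow q (x + c • y) ≤ 2 ^ q * bracketPow q x :=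
      bracketPow_le_of_japanese_le hq two_pos (japanese_le_of_norm_le one_le_two hx)
    calc _ ≤ (2 ^ q * bracketPow q x) * (2 ^ q * bracketPow q y) := by gcongr
      _ = 2 ^ q * (2 ^ q + 0) * bracketPow q x * (bracketPow q y + 0) := by ring
      _ ≤ _ := by gcongr; positivity
  · push Not at hx
    have h3 : ‖x‖ ≤ ‖x + c • y‖ + |c| * ‖y‖ := by
      simpa [norm_smul] using norm_sub_le (x + c • y) (c • y)
    have hc : c ≠ 0 := by
      rintro rfl
      have := norm_nonneg x
      simp at hx; linarith
    have h4 : ‖x‖ ≤ (1 + 2 * |c|) * ‖y‖ := by nlinarith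
    have h5 : bracketPow q y ≤ (1 + 2 * |c|) ^ q * bracketPow q x :=
      bracketPow_le_of_japanese_le hq (by positivity)
        (japanese_le_of_norm_le (by linarith [abs_nonneg c]) h4)
    rw [if_neg hc]
    calc _ ≤ bracketPow q (x + c • y) * (2 ^ q * ((1 + 2 * |c|) ^ q * bracketPow q x)) := by
          gcongr
          exact h1.trans (by gcongr)
      _ = 2 ^ q * (0 + (1 + 2 * |c|) ^ q) * bracketPow q x * (0 + bracketPow q (x + c • y)) := by
          ring
      _ ≤ _ := by gcongr; positivity

lemma abs_centralDiff_iterate_le_sum (y : EuclideanSpace ℝ (Fin n)) (N : ℕ)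
    (f : EuclideanSpace ℝ (Fin n) → ℝ) (x : EuclideanSpace ℝ (Fin n)) :
    |(centralDiff y)^[N] f x| ≤
      ∑ k ∈ Finset.range (N + 1), (N.choose k : ℝ) * |f (x + ((k : ℝ) - N / 2) • y)| := by
  rw [centralDiff_iterate_eq, fwdDiff_iter_eq_sum_shift]
  refine (Finset.abs_sum_le_sum_abs _ _).trans (Finset.sum_le_sum fun k _ => le_of_eq ?_)
  rw [zsmul_eq_mul, abs_mul]
  congr 1
  · push_cast
    rw [abs_mul, abs_pow]
    simp
  · congr 2
    rw [← Nat.cast_smul_eq_nsmul ℝ]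
    module

/-- The singular integral defining `(-Δ)^σ ⟨x⟩^{-q}`, `q = n + 2s`, decays like `⟨x⟩^{-q}` when
`s ≤ σ`. -/
lemma exists_abs_integral_centralDiff_le [NeZero n] {s σ : ℝ} (hs : 0 < s) (hσ : s ≤ σ) {N : ℕ}
    (hN : 2 * σ < N) :
    ∃ C : ℝ, 0 ≤ C ∧ ∀ x : EuclideanSpace ℝ (Fin n),
      |∫ y : EuclideanSpace ℝ (Fin n), (centralDiff y)^[N] (bracketPow ((n : ℝ) + 2 * s)) x /
        ‖y‖ ^ ((n : ℝ) + 2 * σ)| ≤ C * bracketPow ((n : ℝ) + 2 * s) x := by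
  set q : ℝ := (n : ℝ) + 2 * s with hqdef
  have hq : 0 ≤ q := by positivity
  have hint : Integrable (bracketPow (n := n) q) := integrable_bracketPow (by linarith)
  obtain ⟨C₀, hC₀, near⟩ := exists_abs_centralDiff_iterate_le (n := n) hq N 0 q (by simp)
  have near' : ∀ x y : EuclideanSpace ℝ (Fin n), ‖y‖ ≤ 1 →
      |(centralDiff y)^[N] (bracketPow q) x| ≤ C₀ * ‖y‖ ^ N * bracketPow q x := by
    simpa using near
  choose K hK far using fun k : ℕ =>
    exists_bracketPow_add_smul_div_le (n := n) hs hσ ((k : ℝ) - N / 2)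
  set A : EuclideanSpace ℝ (Fin n) → ℝ := fun y =>
    if ‖y‖ ≤ 1 then ‖y‖ ^ N / ‖y‖ ^ ((n : ℝ) + 2 * σ) else 0 with hA
  have hAint : Integrable A := integrable_indicator_closedBall_pow_div_rpow hN
  have hA0 : ∀ y, 0 ≤ A y := fun y => by simp only [hA]; split_ifs <;> positivity
  set w : ℕ → EuclideanSpace ℝ (Fin n) → EuclideanSpace ℝ (Fin n) → ℝ := fun k x y =>
    bracketPow q y + if (k : ℝ) - N / 2 = 0 then 0 else bracketPow q (x + ((k : ℝ) - N / 2) • y)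
    with hw
  have hw0 : ∀ k x y, 0 ≤ w k x y := fun k x y => by
    have := bracketPow_pos q y
    have := bracketPow_pos q (x + ((k : ℝ) - N / 2) • y)
    simp only [hw]; split_ifs <;> linarith
  have hwint : ∀ k, ∃ D : ℝ, 0 ≤ D ∧ ∀ x, Integrable (w k x) ∧ ∫ y, w k x y = D := by
    intro k
    by_cases h : (k : ℝ) - N / 2 = 0
    · refine ⟨∫ y : EuclideanSpace ℝ (Fin n), bracketPow q y,
        integral_nonneg fun y => (bracketPow_pos q y).le, fun x => ?_⟩
      simp only [hw, h, if_true, add_zero]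
      exact ⟨hint, trivial⟩
    · have h1 : ∀ x : EuclideanSpace ℝ (Fin n), Integrable fun y =>
          bracketPow q (x + ((k : ℝ) - N / 2) • y) := fun x =>
        (hint.comp_add_left x).comp_smul h
      have h2 : ∀ x : EuclideanSpace ℝ (Fin n), ∫ y, bracketPow q (x + ((k : ℝ) - N / 2) • y) =
          |(((k : ℝ) - N / 2) ^ n)⁻¹| * ∫ y : EuclideanSpace ℝ (Fin n), bracketPow q y := by
        intro x
        rw [Measure.integral_comp_smul volume (fun y => bracketPow q (x + y)),
          integral_add_left_eq_self (bracketPow q) x]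
        simp
      have h3 : (0 : ℝ) ≤ ∫ y : EuclideanSpace ℝ (Fin n), bracketPow q y :=
        integral_nonneg fun y => (bracketPow_pos q y).le
      refine ⟨(∫ y : EuclideanSpace ℝ (Fin n), bracketPow q y) + |(((k : ℝ) - N / 2) ^ n)⁻¹| *
        ∫ y : EuclideanSpace ℝ (Fin n), bracketPow q y, by positivity, fun x => ?_⟩
      simp only [hw, h, if_false]
      exact ⟨hint.add (h1 x), by rw [integral_add hint (h1 x), h2]⟩
  choose D hD0 hwD using hwint
  refine ⟨C₀ * (∫ y, A y) + ∑ k ∈ Finset.range (N + 1), N.choose k * K k * D k, ?_, fun x => ?_⟩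
  · have : 0 ≤ ∫ y, A y := integral_nonneg hA0
    have := Finset.sum_nonneg fun k (_ : k ∈ Finset.range (N + 1)) =>
      mul_nonneg (mul_nonneg (Nat.cast_nonneg (α := ℝ) (N.choose k)) (hK k)) (hD0 k)
    positivity
  have px := bracketPow_pos q x
  set B : EuclideanSpace ℝ (Fin n) → ℝ := fun y => bracketPow q x *
    (C₀ * A y + ∑ k ∈ Finset.range (N + 1), N.choose k * K k * w k x y) with hB
  have hs1 : ∀ y, 0 ≤ ∑ k ∈ Finset.range (N + 1), N.choose k * K k * w k x y := fun y =>
    Finset.sum_nonneg fun k _ =>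
      mul_nonneg (mul_nonneg (Nat.cast_nonneg (α := ℝ) (N.choose k)) (hK k)) (hw0 k x y)
  have hsum : Integrable fun y => ∑ k ∈ Finset.range (N + 1), N.choose k * K k * w k x y :=
    integrable_finsetSum _ fun k _ => (hwD k x).1.const_mul _
  have hBint : Integrable B := ((hAint.const_mul C₀).add hsum).const_mul _
  have hle : ∀ y : EuclideanSpace ℝ (Fin n), ‖(centralDiff y)^[N] (bracketPow q) x /
      ‖y‖ ^ ((n : ℝ) + 2 * σ)‖ ≤ B y := by
    intro y
    have hden : 0 ≤ ‖y‖ ^ ((n : ℝ) + 2 * σ) := by positivity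
    rw [Real.norm_eq_abs, abs_div, abs_of_nonneg hden]
    by_cases hy : ‖y‖ ≤ 1
    · calc _ ≤ (C₀ * ‖y‖ ^ N * bracketPow q x) / ‖y‖ ^ ((n : ℝ) + 2 * σ) := by
            gcongr
            exact near' x y hy
        _ = bracketPow q x * (C₀ * A y + 0) := by simp only [hA, hy, if_true]; ring
        _ ≤ B y := by
            simp only [hB]
            gcongr
            exact hs1 y
    · push Not at hy
      calc _ ≤ (∑ k ∈ Finset.range (N + 1), (N.choose k : ℝ) *
              |bracketPow q (x + ((k : ℝ) - N / 2) • y)|) / ‖y‖ ^ ((n : ℝ) + 2 * σ) := by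
            gcongr
            exact abs_centralDiff_iterate_le_sum y N _ x
        _ ≤ ∑ k ∈ Finset.range (N + 1), bracketPow q x * (N.choose k * K k * w k x y) := by
            rw [Finset.sum_div]
            refine Finset.sum_le_sum fun k _ => ?_
            rw [abs_of_pos (bracketPow_pos _ _), mul_div_assoc]
            calc _ ≤ (N.choose k : ℝ) * (K k * bracketPow q x * w k x y) := by
                  gcongr
                  exact far k x y hy
              _ = _ := by ring
        _ = bracketPow q x * (0 + ∑ k ∈ Finset.range (N + 1), N.choose k * K k * w k x y) := by
            rw [zero_add, Finset.mul_sum]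
        _ ≤ B y := by
            simp only [hB]
            gcongr
            exact mul_nonneg hC₀ (hA0 y)
  refine (norm_integral_le_of_norm_le hBint (Eventually.of_forall hle)).trans_eq ?_
  simp only [hB]
  rw [integral_const_mul, integral_add (hAint.const_mul C₀) hsum, integral_const_mul,
    integral_finsetSum _ fun k _ => (hwD k x).1.const_mul _, mul_comm]
  congr 2
  refine Finset.sum_congr rfl fun k _ => ?_
  rw [integral_const_mul, (hwD k x).2]

end NonInteger

/-! ### The fractional Laplacian of a bracket power: integer exponents -/

section Integer

variable {n : ℕ}

lemma laplacian_bracketPow (r : ℝ) (x : EuclideanSpace ℝ (Fin n)) :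
    Laplacian.laplacian (bracketPow (n := n) r) x =
      (r * (r + 2 - n)) * bracketPow (r + 2) x + (-(r * (r + 2))) * bracketPow (r + 4) x := by
  obtain ⟨L, hL⟩ : ∃ L : EuclideanSpace ℝ (Fin n) →L[ℝ] EuclideanSpace ℝ (Fin n) →L[ℝ] ℝ,
      ∀ a, L a = innerSL ℝ a := ⟨innerSL ℝ, fun _ => rfl⟩
  have h1 : fderiv ℝ (bracketPow (n := n) r) = fun x => (-r * bracketPow (r + 2) x) • L x :=
    funext fun x => by rw [hL]; exact (hasFDerivAt_bracketPow r x).fderiv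
  have h2 := ((hasFDerivAt_bracketPow (r + 2) x).const_mul (-r)).smul (L.hasFDerivAt (x := x))
  have h3 := (show HasFDerivAt (fderiv ℝ (bracketPow (n := n) r)) _ x by rw [h1]; exact h2).fderiv
  rw [InnerProductSpace.laplacian_eq_iteratedFDeriv_orthonormalBasis _
    (EuclideanSpace.basisFun (Fin n) ℝ)]
  have h4 := (EuclideanSpace.basisFun (Fin n) ℝ).sum_sq_norm_inner_right x
  have hterm : ∀ i, iteratedFDeriv ℝ 2 (bracketPow (n := n) r) x
      ![EuclideanSpace.basisFun (Fin n) ℝ i, EuclideanSpace.basisFun (Fin n) ℝ i] =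
      -r * bracketPow (r + 2) x +
        r * (r + 2) * bracketPow (r + 4) x * ‖inner ℝ (EuclideanSpace.basisFun (Fin n) ℝ i) x‖ ^ 2 := by
    intro i
    have h5 := (EuclideanSpace.basisFun (Fin n) ℝ).norm_eq_one i
    generalize EuclideanSpace.basisFun (Fin n) ℝ i = e at h5
    rw [iteratedFDeriv_two_apply, h3, show r + 2 + 2 = r + 4 by ring]
    simp only [Matrix.cons_val_zero, Matrix.cons_val_one, add_apply,
      smul_apply, ContinuousLinearMap.smulRight_apply, smul_eq_mul, hL,
      innerSL_apply_apply, real_inner_self_eq_norm_sq, h5, Real.norm_eq_abs, sq_abs,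
      real_inner_comm x e]
    ring
  simp only [hterm, Finset.sum_add_distrib, ← Finset.mul_sum, h4]
  have h6 : bracketPow (r + 2) x = (1 + ‖x‖ ^ 2) * bracketPow (r + 4) x := by
    rw [← japanese_sq, bracketPow, bracketPow, ← Real.rpow_natCast, ← Real.rpow_add (japanese_pos x)]
    congr 1
    push_cast; ring
  simp only [Finset.sum_const, Finset.card_univ, Fintype.card_fin, nsmul_eq_mul]
  linear_combination -r * (r + 2) * h6

variable (n) in
/-- The linear span of the functions `⟨x⟩^{-r}` with `r ≥ q`, which is stable under `-Δ`. -/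
def bracketSpan (q : ℝ) : Submodule ℝ (EuclideanSpace ℝ (Fin n) → ℝ) :=
  Submodule.span ℝ {f | ∃ r, q ≤ r ∧ f = bracketPow r}

lemma bracketPow_mem_bracketSpan {q r : ℝ} (h : q ≤ r) : bracketPow r ∈ bracketSpan n q :=
  Submodule.subset_span ⟨r, h, rfl⟩

lemma contDiff_of_mem_bracketSpan {q : ℝ} {f : EuclideanSpace ℝ (Fin n) → ℝ}
    (hf : f ∈ bracketSpan n q) : ContDiff ℝ ((⊤ : ℕ∞) : WithTop ℕ∞) f := by
  induction hf using Submodule.span_induction with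
  | mem f hf =>
    obtain ⟨r, -, rfl⟩ := hf
    exact contDiff_bracketPow r
  | zero => exact contDiff_const
  | add f g _ _ hf hg => exact hf.add hg
  | smul c f _ hf => exact hf.const_smul c

lemma exists_abs_le_of_mem_bracketSpan {q : ℝ} {f : EuclideanSpace ℝ (Fin n) → ℝ}
    (hf : f ∈ bracketSpan n q) : ∃ C : ℝ, 0 ≤ C ∧ ∀ x, |f x| ≤ C * bracketPow q x := by
  induction hf using Submodule.span_induction with
  | mem f hf =>
    obtain ⟨r, hr, rfl⟩ := hf
    refine ⟨1, zero_le_one, fun x => ?_⟩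
    rw [abs_of_pos (bracketPow_pos r x), one_mul]
    exact bracketPow_anti hr x
  | zero => exact ⟨0, le_rfl, fun x => by simp⟩
  | add f g _ _ hf hg =>
    obtain ⟨C, hC, hf⟩ := hf
    obtain ⟨D, hD, hg⟩ := hg
    refine ⟨C + D, by positivity, fun x => (abs_add_le _ _).trans ?_⟩
    rw [add_mul]
    exact add_le_add (hf x) (hg x)
  | smul c f _ hf =>
    obtain ⟨C, hC, hf⟩ := hf
    refine ⟨|c| * C, by positivity, fun x => ?_⟩
    rw [Pi.smul_apply, smul_eq_mul, abs_mul, mul_assoc]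
    exact mul_le_mul_of_nonneg_left (hf x) (abs_nonneg c)

lemma neg_laplacian_mem_bracketSpan {q : ℝ} {f : EuclideanSpace ℝ (Fin n) → ℝ}
    (hf : f ∈ bracketSpan n q) : (fun x => -(Laplacian.laplacian f x)) ∈ bracketSpan n q := by
  have hd : ∀ {g : EuclideanSpace ℝ (Fin n) → ℝ}, g ∈ bracketSpan n q →
      ∀ x, ContDiffAt ℝ 2 g x := fun hg x =>
    ((contDiff_of_mem_bracketSpan hg).of_le (WithTop.coe_le_coe.2 (le_top : (2 : ℕ∞) ≤ ⊤))).contDiffAt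
  induction hf using Submodule.span_induction with
  | mem f hf =>
    obtain ⟨r, hr, rfl⟩ := hf
    have : (fun x => -(Laplacian.laplacian (bracketPow (n := n) r) x)) =
        (-(r * (r + 2 - n))) • bracketPow (r + 2) + (r * (r + 2)) • bracketPow (r + 4) := by
      funext x
      simp only [laplacian_bracketPow, Pi.add_apply, Pi.smul_apply, smul_eq_mul]
      ring
    rw [this]
    exact Submodule.add_mem _
      (Submodule.smul_mem _ _ (bracketPow_mem_bracketSpan (by linarith)))
      (Submodule.smul_mem _ _ (bracketPow_mem_bracketSpan (by linarith)))
  | zero =>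
    have : (fun x => -(Laplacian.laplacian (0 : EuclideanSpace ℝ (Fin n) → ℝ) x)) = 0 := by
      have h : (0 : EuclideanSpace ℝ (Fin n) → ℝ) = fun _ => 0 := rfl
      rw [h, InnerProductSpace.laplacian_const]
      funext x
      simp
    rw [this]
    exact Submodule.zero_mem _
  | add f g hf' hg' hf hg =>
    have : (fun x => -(Laplacian.laplacian (f + g) x)) =
        (fun x => -(Laplacian.laplacian f x)) + fun x => -(Laplacian.laplacian g x) := by
      funext x
      rw [(hd hf' x).laplacian_add (hd hg' x), Pi.add_apply]
      ring
    rw [this]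
    exact Submodule.add_mem _ hf hg
  | smul c f hf' hf =>
    have : (fun x => -(Laplacian.laplacian (c • f) x)) =
        c • fun x => -(Laplacian.laplacian f x) := by
      funext x
      rw [InnerProductSpace.laplacian_smul c (hd hf' x), Pi.smul_apply]
      simp
    rw [this]
    exact Submodule.smul_mem _ _ hf

lemma neg_laplacian_iterate_mem_bracketSpan {q : ℝ} (k : ℕ) :
    (fun h : EuclideanSpace ℝ (Fin n) → ℝ => fun x => -(Laplacian.laplacian h x))^[k]
      (bracketPow q) ∈ bracketSpan n q := by
  induction k with
  | zero => exact bracketPow_mem_bracketSpan le_rfl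
  | succ k ih =>
    rw [Function.iterate_succ_apply']
    exact neg_laplacian_mem_bracketSpan ih

lemma laplacian_comp_smul (c : ℝ) {f : EuclideanSpace ℝ (Fin n) → ℝ} (hf : ContDiff ℝ 2 f)
    (x : EuclideanSpace ℝ (Fin n)) :
    Laplacian.laplacian (fun z => f (c • z)) x = c ^ 2 * Laplacian.laplacian f (c • x) := by
  have h : (fun z => f (c • z)) =
      f ∘ (c • ContinuousLinearMap.id ℝ (EuclideanSpace ℝ (Fin n))) := by
    funext z; simp
  simp only [InnerProductSpace.laplacian_eq_iteratedFDeriv_stdOrthonormalBasis, Finset.mul_sum]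
  refine Finset.sum_congr rfl fun i _ => ?_
  rw [h, ContinuousLinearMap.iteratedFDeriv_comp_right _ hf x le_rfl,
    ContinuousMultilinearMap.compContinuousLinearMap_apply]
  have := (iteratedFDeriv ℝ 2 f (c • x)).map_smul_univ (fun _ => c)
    ![stdOrthonormalBasis ℝ (EuclideanSpace ℝ (Fin n)) i,
      stdOrthonormalBasis ℝ (EuclideanSpace ℝ (Fin n)) i]
  simp only [Finset.prod_const, Finset.card_univ, Fintype.card_fin, smul_eq_mul] at this
  rw [← this]
  simp

end Integer

/-! ### Decay and scaling of the fractional Laplacian -/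

section FracLap

variable {n : ℕ} [NeZero n]

lemma fracLap_zero (f : EuclideanSpace ℝ (Fin n) → ℝ) : fracLap 0 f = f := by
  simp [fracLap]

/-- The function `⟨x⟩^{-n-2s}` controls its fractional Laplacians of all admissible orders. -/
lemma exists_abs_fracLap_bracketPow_le {s σ : ℝ} (hs : 0 < s) (hσ : 0 ≤ σ)
    (h : Int.fract σ = 0 ∨ s ≤ Int.fract σ) :
    ∃ C : ℝ, 0 ≤ C ∧ ∀ x : EuclideanSpace ℝ (Fin n),
      |fracLap σ (bracketPow ((n : ℝ) + 2 * s)) x| ≤ C * bracketPow ((n : ℝ) + 2 * s) x := by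
  by_cases h0 : Int.fract σ = 0
  · simp only [fracLap, h0, if_true]
    exact exists_abs_le_of_mem_bracketSpan (neg_laplacian_iterate_mem_bracketSpan _)
  · have hs' : s ≤ σ := (h.resolve_left h0).trans
      (by have := Int.floor_nonneg.2 hσ
          have : (0 : ℝ) ≤ (⌊σ⌋ : ℝ) := by exact_mod_cast this
          have := Int.floor_add_fract σ
          linarith)
    obtain ⟨C, hC, hb⟩ := exists_abs_integral_centralDiff_le (n := n) hs hs'
      (N := 2 * ⌊σ⌋₊ + 2) (by push_cast; linarith [Nat.lt_floor_add_one σ])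
    refine ⟨|(-1 : ℝ) ^ (⌊σ⌋₊ + 1) * fracConst n σ| * C, by positivity, fun x => ?_⟩
    simp only [fracLap, h0, if_false]
    rw [abs_mul, mul_assoc]
    exact mul_le_mul_of_nonneg_left (hb x) (abs_nonneg _)

lemma fracLap_comp_smul {q σ c : ℝ} (hc : 0 < c) (hσ : 0 ≤ σ)
    (x : EuclideanSpace ℝ (Fin n)) :
    fracLap σ (fun z => bracketPow q (c • z)) x = c ^ (2 * σ) * fracLap σ (bracketPow q) (c • x) := by
  by_cases h0 : Int.fract σ = 0
  · simp only [fracLap, h0, if_true]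
    have hσk : σ = (⌊σ⌋₊ : ℝ) := by
      rw [natCast_floor_eq_intCast_floor hσ]
      have := Int.floor_add_fract σ
      linarith
    have key : ∀ k : ℕ, (fun h : EuclideanSpace ℝ (Fin n) → ℝ =>
        fun x => -(Laplacian.laplacian h x))^[k] (fun z => bracketPow q (c • z)) =
        fun z => c ^ (2 * k) * (fun h : EuclideanSpace ℝ (Fin n) → ℝ =>
        fun x => -(Laplacian.laplacian h x))^[k] (bracketPow q) (c • z) := by
      intro k
      induction k with
      | zero => simp
      | succ k ih =>
        rw [Function.iterate_succ_apply', Function.iterate_succ_apply', ih]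
        have hf : ContDiff ℝ 2 ((fun h : EuclideanSpace ℝ (Fin n) → ℝ =>
            fun x => -(Laplacian.laplacian h x))^[k] (bracketPow q)) :=
          (contDiff_of_mem_bracketSpan (neg_laplacian_iterate_mem_bracketSpan (q := q) k)).of_le
            (WithTop.coe_le_coe.2 (le_top : (2 : ℕ∞) ≤ ⊤))
        funext z
        have h1 := InnerProductSpace.laplacian_smul (c ^ (2 * k))
          ((hf.comp (contDiff_const_smul c)).contDiffAt (x := z))
        have h2 := laplacian_comp_smul c hf z
        simp only [Function.comp_def] at h1
        rw [h2, smul_eq_mul] at h1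
        refine (congrArg Neg.neg h1).trans ?_
        ring
    rw [key]
    rw [← Real.rpow_natCast]
    push_cast
    rw [← hσk]
  · simp only [fracLap, h0, if_false, centralDiff_iterate_comp_smul]
    have h1 : ∀ y : EuclideanSpace ℝ (Fin n),
        (centralDiff (c • y))^[2 * ⌊σ⌋₊ + 2] (bracketPow q) (c • x) / ‖y‖ ^ ((n : ℝ) + 2 * σ) =
        c ^ ((n : ℝ) + 2 * σ) * ((centralDiff (c • y))^[2 * ⌊σ⌋₊ + 2] (bracketPow q) (c • x) /
          ‖c • y‖ ^ ((n : ℝ) + 2 * σ)) := by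
      intro y
      rw [norm_smul, Real.norm_of_nonneg hc.le, Real.mul_rpow hc.le (norm_nonneg y)]
      have := Real.rpow_pos_of_pos hc ((n : ℝ) + 2 * σ)
      field_simp
    simp_rw [h1]
    rw [integral_const_mul, Measure.integral_comp_smul volume (fun y : EuclideanSpace ℝ (Fin n) =>
      (centralDiff y)^[2 * ⌊σ⌋₊ + 2] (bracketPow q) (c • x) / ‖y‖ ^ ((n : ℝ) + 2 * σ)),
      Real.rpow_add hc, Real.rpow_natCast, finrank_euclideanSpace, Fintype.card_fin,
      abs_of_pos (by positivity), smul_eq_mul]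
    have := pow_pos hc n
    field_simp

lemma exists_abs_fracLap_bracketPow_inv_smul_le {s σ : ℝ} (hs : 0 < s) (hσ : 0 ≤ σ)
    (h : Int.fract σ = 0 ∨ s ≤ Int.fract σ) :
    ∃ C : ℝ, 0 ≤ C ∧ ∀ R : ℝ, 0 < R → ∀ x : EuclideanSpace ℝ (Fin n),
      |fracLap σ (fun z => bracketPow ((n : ℝ) + 2 * s) (R⁻¹ • z)) x| ≤
        C * R ^ (-(2 * σ)) * bracketPow ((n : ℝ) + 2 * s) (R⁻¹ • x) := by
  obtain ⟨C, hC, hb⟩ := exists_abs_fracLap_bracketPow_le (n := n) hs hσ h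
  refine ⟨C, hC, fun R hR x => ?_⟩
  have h1 : R⁻¹ ^ (2 * σ) = R ^ (-(2 * σ)) := by rw [Real.inv_rpow hR.le, Real.rpow_neg hR.le]
  rw [fracLap_comp_smul (inv_pos.2 hR) hσ, abs_mul, abs_of_pos (by positivity), h1, mul_comm C,
    mul_assoc]
  have := Real.rpow_nonneg hR.le (-(2 * σ))
  gcongr
  exact hb _

/-- The rescaled bracket power `⟨x / R⟩^{-n-2s}` is an admissible test function. -/
lemma isTestFunction_bracketPow_inv_smul {s R : ℝ} (hs : 0 < s) (hR : 1 ≤ R) :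
    IsTestFunction (n := n) s (fun x => bracketPow ((n : ℝ) + 2 * s) (R⁻¹ • x)) := by
  set q : ℝ := (n : ℝ) + 2 * s with hq
  have hR0 : 0 < R := by linarith
  have hq0 : 0 ≤ q := by positivity
  have hdec : ∀ x : EuclideanSpace ℝ (Fin n), japanese x ^ q * bracketPow q (R⁻¹ • x) ≤ R ^ q := by
    intro x
    have h1 : japanese x ≤ R * japanese (R⁻¹ • x) := by
      refine japanese_le_of_norm_le hR ?_
      rw [norm_smul, norm_inv, Real.norm_of_nonneg hR0.le, mul_inv_cancel_left₀ hR0.ne']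
    have h2 := bracketPow_le_of_japanese_le hq0 hR0 h1
    have h3 := Real.rpow_pos_of_pos (japanese_pos x) q
    calc _ ≤ japanese x ^ q * (R ^ q * bracketPow q x) := by gcongr
      _ = R ^ q := by
        rw [bracketPow, Real.rpow_neg (japanese_pos x).le]
        field_simp
  refine ⟨(contDiff_bracketPow q).comp (contDiff_const_smul _), ⟨R ^ q, fun x => ?_⟩,
    fun σ hσ h => ?_⟩
  · rw [abs_of_pos (bracketPow_pos _ _)]
    exact hdec x
  · obtain ⟨C, hC, hb⟩ := exists_abs_fracLap_bracketPow_inv_smul_le (n := n) hs hσ.le h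
    refine ⟨C * R ^ (-(2 * σ)) * R ^ q, fun x => ?_⟩
    have h3 := Real.rpow_pos_of_pos (japanese_pos x) q
    calc _ ≤ japanese x ^ q * (C * R ^ (-(2 * σ)) * bracketPow q (R⁻¹ • x)) := by
          gcongr
          exact hb R hR0 x
      _ = C * R ^ (-(2 * σ)) * (japanese x ^ q * bracketPow q (R⁻¹ • x)) := by ring
      _ ≤ _ := by
          gcongr
          exact hdec x

end FracLap

/-! ### Cutoff functions in time -/

section Time

lemma exists_iteratedDeriv_pow_eq {χ : ℝ → ℝ} (hχ : ContDiff ℝ ((⊤ : ℕ∞) : WithTop ℕ∞) χ)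
    {N k : ℕ} (hk : k ≤ N) : ∃ g : ℝ → ℝ, ContDiff ℝ ((⊤ : ℕ∞) : WithTop ℕ∞) g ∧
      iteratedDeriv k (fun t => χ t ^ N) = fun t => χ t ^ (N - k) * g t := by
  induction k with
  | zero => exact ⟨fun _ => 1, contDiff_const, by simp⟩
  | succ k ih =>
    obtain ⟨g, hg, h⟩ := ih (by omega)
    have hd : ∀ {f : ℝ → ℝ}, ContDiff ℝ ((⊤ : ℕ∞) : WithTop ℕ∞) f → Differentiable ℝ f :=
      fun hf => hf.differentiable (by simp)
    have hd' : ∀ {f : ℝ → ℝ}, ContDiff ℝ ((⊤ : ℕ∞) : WithTop ℕ∞) f →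
        ContDiff ℝ ((⊤ : ℕ∞) : WithTop ℕ∞) (deriv f) := fun hf =>
      (contDiff_infty_iff_deriv.1 hf).2
    refine ⟨fun t => ((N - k : ℕ) : ℝ) * deriv χ t * g t + χ t * deriv g t,
      ((contDiff_const.mul (hd' hχ)).mul hg).add (hχ.mul (hd' hg)), ?_⟩
    rw [iteratedDeriv_succ, h]
    funext t
    have h1 := ((hd hχ t).hasDerivAt.pow (N - k)).mul (hd hg t).hasDerivAt
    refine h1.deriv.trans ?_
    simp only [Pi.pow_apply]
    obtain ⟨j, hj⟩ : ∃ j, N - k = j + 1 := ⟨N - k - 1, by omega⟩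
    rw [show N - (k + 1) = j by omega, hj]
    simp only [Nat.add_sub_cancel]
    ring

/-- For a nonincreasing cutoff, the compactly supported primitives inherit the bound by a multiple
of the cutoff. -/
lemma exists_abs_tailPrimitive_iterate_le {ψ : ℝ → ℝ} (hanti : Antitone ψ) (h0 : ∀ t, 0 ≤ ψ t)
    (h2 : ∀ t, 2 ≤ t → ψ t = 0) (k : ℕ) :
    ∃ C : ℝ, 0 ≤ C ∧ ∀ t, 0 ≤ t → |tailPrimitive^[k] ψ t| ≤ C * ψ t := by
  induction k with
  | zero => exact ⟨1, zero_le_one, fun t _ => by simp [abs_of_nonneg (h0 t)]⟩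
  | succ k ih =>
    obtain ⟨C, hC, h⟩ := ih
    refine ⟨C * 2, by positivity, fun t ht => ?_⟩
    rw [Function.iterate_succ_apply', tailPrimitive, abs_neg]
    have hz : ∀ τ, 2 ≤ τ → tailPrimitive^[k] ψ τ = 0 := fun τ hτ => by
      have := h τ (by linarith)
      rw [h2 τ hτ, mul_zero] at this
      exact abs_nonpos_iff.1 this
    have he : ∫ τ in Set.Ioi t, tailPrimitive^[k] ψ τ =
        ∫ τ in Set.Ioc t 2, tailPrimitive^[k] ψ τ := by
      refine (setIntegral_eq_of_subset_of_forall_sdiff_eq_zero measurableSet_Ioi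
        Set.Ioc_subset_Ioi_self fun τ hτ => hz τ ?_)
      by_contra hlt
      exact hτ.2 ⟨hτ.1, by linarith⟩
    rw [he]
    have hb := norm_setIntegral_le_of_norm_le_const (μ := volume) (s := Set.Ioc t 2)
      (f := tailPrimitive^[k] ψ) (C := C * ψ t) (by simp) (fun τ hτ =>
        (h τ (ht.trans hτ.1.le)).trans (mul_le_mul_of_nonneg_left (hanti hτ.1.le) hC))
    refine hb.trans ?_
    rw [Measure.real, Real.volume_Ioc, ENNReal.toReal_ofReal']
    have : max (2 - t) 0 ≤ 2 := max_le (by linarith) two_pos.le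
    nlinarith [mul_nonneg hC (h0 t)]

/-- There is a nonincreasing cutoff whose derivatives up to order `K` are dominated by its
`1/p`-th power: a large power of a smooth step. -/
lemma exists_timeCutoff {p : ℝ} (hp : 1 < p) (K : ℕ) :
    ∃ ψ : ℝ → ℝ, ContDiff ℝ ((⊤ : ℕ∞) : WithTop ℕ∞) ψ ∧ Antitone ψ ∧ (∀ t, 0 ≤ ψ t) ∧
      (∀ t, ψ t ≤ 1) ∧ (∀ t, t ≤ 1 → ψ t = 1) ∧ (∀ t, 2 ≤ t → ψ t = 0) ∧
      ∀ k : ℤ, k ≤ K → ∃ C : ℝ, 0 ≤ C ∧ ∀ t, 0 ≤ t → |timeDeriv ψ k t| ≤ C * ψ t ^ (1 / p) := by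
  set χ : ℝ → ℝ := fun t => Real.smoothTransition (2 - t) with hχdef
  have hχ : ContDiff ℝ ((⊤ : ℕ∞) : WithTop ℕ∞) χ :=
    Real.smoothTransition.contDiff.comp (contDiff_const.sub contDiff_id)
  have hχ0 : ∀ t, 0 ≤ χ t := fun t => Real.smoothTransition.nonneg _
  have hχ1 : ∀ t, χ t ≤ 1 := fun t => Real.smoothTransition.le_one _
  have hχ2 : ∀ t, 2 ≤ t → χ t = 0 := fun t ht =>
    Real.smoothTransition.zero_of_nonpos (by linarith)
  have hp0 : 0 < p := by linarith
  -- The power `N` is so large that `N - K ≥ N / p`.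
  obtain ⟨N, hN⟩ := exists_nat_gt (K * p / (p - 1))
  have hN' : (K : ℝ) * p < N * (p - 1) := by rwa [div_lt_iff₀ (by linarith)] at hN
  have hKN : K < N := by
    have : (K : ℝ) * p < N * p := by nlinarith [(Nat.cast_nonneg N : (0 : ℝ) ≤ N)]
    exact_mod_cast lt_of_mul_lt_mul_right this hp0.le
  have hanti : Antitone fun t => χ t ^ N := fun a b hab =>
    pow_le_pow_left₀ (hχ0 b) (Real.smoothTransition.monotone (by linarith)) N
  have hz : ∀ t, 2 ≤ t → χ t ^ N = 0 := fun t ht => by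
    rw [hχ2 t ht, zero_pow (by omega)]
  have hle : ∀ t, χ t ^ N ≤ 1 := fun t => pow_le_one₀ (hχ0 t) (hχ1 t)
  refine ⟨fun t => χ t ^ N, hχ.pow N, hanti, fun t => pow_nonneg (hχ0 t) N, hle,
    fun t ht => ?_, hz, fun k hk => ?_⟩
  · simp only [hχdef]
    rw [Real.smoothTransition.one_of_one_le (by linarith), one_pow]
  rcases k with k | k
  · have hkK : k ≤ K := by
      rw [Int.ofNat_eq_natCast] at hk
      exact_mod_cast hk
    obtain ⟨g, hg, h⟩ := exists_iteratedDeriv_pow_eq hχ (N := N) (k := k) (by omega)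
    obtain ⟨M, hM⟩ := (isCompact_Icc (a := (0 : ℝ)) (b := 2)).exists_bound_of_continuousOn
      hg.continuous.continuousOn
    refine ⟨|M|, abs_nonneg M, fun t ht => ?_⟩
    simp only [timeDeriv]
    rw [h]
    by_cases h2 : 2 ≤ t
    · simp only
      rw [hχ2 t h2, zero_pow (by omega), zero_mul, abs_zero]
      positivity
    · have hgM : |g t| ≤ |M| := (hM t ⟨ht, by linarith⟩).trans (le_abs_self M)
      have hpos : 0 < χ t := Real.smoothTransition.pos_of_pos (by linarith)
      rw [abs_mul, abs_of_nonneg (pow_nonneg (hχ0 t) _), mul_comm]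
      refine mul_le_mul hgM ?_ (pow_nonneg (hχ0 t) _) (abs_nonneg _)
      rw [← Real.rpow_natCast, ← Real.rpow_natCast, ← Real.rpow_mul (hχ0 t)]
      refine Real.rpow_le_rpow_of_exponent_ge hpos (hχ1 t) ?_
      rw [Nat.cast_sub (by omega), mul_one_div, div_le_iff₀ hp0]
      have : (k : ℝ) ≤ K := by exact_mod_cast hkK
      nlinarith
  · obtain ⟨C, hC, h⟩ := exists_abs_tailPrimitive_iterate_le hanti
      (fun t => pow_nonneg (hχ0 t) N) hz (k + 1)
    refine ⟨C, hC, fun t ht => (h t ht).trans (mul_le_mul_of_nonneg_left ?_ hC)⟩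
    exact Real.self_le_rpow_of_le_one (pow_nonneg (hχ0 t) N) (hle t)
      ((div_le_one hp0).2 hp.le)

lemma timeDeriv_comp_mul {ψ : ℝ → ℝ} (hψ : ContDiff ℝ ((⊤ : ℕ∞) : WithTop ℕ∞) ψ) {c : ℝ}
    (hc : 0 < c) (k : ℤ) (t : ℝ) :
    timeDeriv (fun t => ψ (c * t)) k t = c ^ k * timeDeriv ψ k (c * t) := by
  rcases k with k | k
  · simp only [timeDeriv, Int.ofNat_eq_natCast, zpow_natCast]
    rw [iteratedDeriv_comp_const_mul (hψ.of_le (by exact_mod_cast le_top))]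
  · simp only [timeDeriv, zpow_negSucc]
    generalize k + 1 = j
    induction j generalizing t with
    | zero => simp
    | succ j ih =>
      rw [Function.iterate_succ_apply', Function.iterate_succ_apply', funext ih, tailPrimitive,
        tailPrimitive, integral_const_mul, integral_comp_mul_left_Ioi _ _ hc, smul_eq_mul, pow_succ,
        mul_inv]
      ring

end Time

/-! ### A growth estimate on the time axis -/

lemma integrable_rpow_one_div {α : Type*} [MeasurableSpace α] {μ : Measure α} [IsFiniteMeasure μ]
    {p : ℝ} (hp : 1 < p) {f : α → ℝ} (hf : Integrable f μ) (hf0 : ∀ x, 0 ≤ f x) :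
    Integrable (fun x => f x ^ (1 / p)) μ := by
  have hp0 : 0 < p := by linarith
  refine (hf.add (integrable_const (1 : ℝ))).mono'
    (hf.aestronglyMeasurable.aemeasurable.pow_const _).aestronglyMeasurable
    (Eventually.of_forall fun t => ?_)
  rw [Real.norm_of_nonneg (Real.rpow_nonneg (hf0 t) _)]
  simp only [Pi.add_apply]
  rcases le_total (f t) 1 with h | h
  · exact (Real.rpow_le_one (hf0 t) h (by positivity)).trans (by linarith [hf0 t])
  · exact (Real.rpow_le_self_of_one_le h ((div_le_one hp0).2 hp.le)).trans (by linarith)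

/-- Hölder's inequality on a finite measure space. -/
lemma integral_rpow_one_div_le {α : Type*} [MeasurableSpace α] {μ : Measure α} [IsFiniteMeasure μ]
    {p : ℝ} (hp : 1 < p) {f : α → ℝ} (hf : Integrable f μ) (hf0 : ∀ x, 0 ≤ f x) :
    ∫ x, f x ^ (1 / p) ∂μ ≤ (∫ x, f x ∂μ) ^ (1 / p) * μ.real Set.univ ^ (1 - 1 / p) := by
  have hp0 : 0 < p := by linarith
  have hpq := Real.HolderConjugate.conjExponent hp
  have hpow : ∀ x, (f x ^ (1 / p)) ^ p = f x := fun x => by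
    rw [← Real.rpow_mul (hf0 x), one_div_mul_cancel hp0.ne', Real.rpow_one]
  have hmem : MemLp (fun x => f x ^ (1 / p)) (ENNReal.ofReal p) μ := by
    rw [← integrable_norm_rpow_iff
      (hf.aestronglyMeasurable.aemeasurable.pow_const _).aestronglyMeasurable
      (by simpa using hp0) ENNReal.ofReal_ne_top, ENNReal.toReal_ofReal hp0.le]
    refine hf.congr (Eventually.of_forall fun x => ?_)
    simp only
    rw [Real.norm_of_nonneg (Real.rpow_nonneg (hf0 x) _), hpow]
  have h := integral_mul_le_Lp_mul_Lq_of_nonneg (μ := μ) hpq (f := fun x => f x ^ (1 / p))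
    (g := fun _ => 1) (Eventually.of_forall fun x => Real.rpow_nonneg (hf0 x) _)
    (Eventually.of_forall fun _ => zero_le_one) hmem (memLp_const 1)
  have he : 1 / p.conjExponent = 1 - 1 / p := by
    have := hpq.inv_add_inv_eq_one
    rw [one_div, one_div]; linarith
  simpa only [mul_one, hpow, Real.one_rpow, integral_const, smul_eq_mul, he] using h

/-- Let the nonnegative densities `H_N`, supported in `[0, 2 S_N]`, increase with `N`. If
`I_N + ε ≤ C S_N^{-(1-1/p)} ∫ H_N^{1/p}` with `I_N = ∫ H_N` and `S_N → ∞`, then Hölder's inequality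
bounds `I_N`, so that the tails of `H_N` are uniformly small, and the right-hand side tends
to `0`. -/
lemma false_of_integral_add_le {p : ℝ} (hp : 1 < p) {H : ℕ → ℝ → ℝ} {S : ℕ → ℝ} {C ε : ℝ}
    (hC : 0 ≤ C) (hε : 0 < ε) (hS : Tendsto S atTop atTop) (hS0 : ∀ N, 0 < S N)
    (hint : ∀ N, IntegrableOn (H N) (Set.Ioi 0)) (hH0 : ∀ N t, 0 ≤ H N t)
    (hmono : ∀ t, 0 < t → Monotone fun N => H N t) (hsupp : ∀ N t, 2 * S N ≤ t → H N t = 0)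
    (hle : ∀ᶠ N in atTop, (∫ t in Set.Ioi (0 : ℝ), H N t) + ε ≤
      C * S N ^ (-(1 - 1 / p)) * ∫ t in Set.Ioi (0 : ℝ), H N t ^ (1 / p)) : False := by
  have hp0 : 0 < p := by linarith
  have hθ : 0 < 1 - 1 / p := by rw [sub_pos, div_lt_one hp0]; exact hp
  set θ := 1 - 1 / p with hθdef
  set I : ℕ → ℝ := fun N => ∫ t in Set.Ioi (0 : ℝ), H N t with hI
  have hI0 : ∀ N, 0 ≤ I N := fun N => integral_nonneg fun t => hH0 N t
  have hImono : Monotone I := fun M N hMN =>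
    setIntegral_mono_on (hint M) (hint N) measurableSet_Ioi fun t ht => hmono t ht hMN
  have hIoc : ∀ {a b : ℝ}, 0 ≤ a → Set.Ioc a b ⊆ Set.Ioi (0 : ℝ) := fun ha t ht =>
    lt_of_le_of_lt ha ht.1
  have hintIoc : ∀ N {a b : ℝ}, 0 ≤ a → IntegrableOn (H N) (Set.Ioc a b) := fun N _ _ ha =>
    (hint N).mono_set (hIoc ha)
  -- Restriction of integrals to bounded intervals.
  have hres : ∀ (f : ℝ → ℝ) (b : ℝ), (∀ t, b ≤ t → f t = 0) →
      ∫ t in Set.Ioi (0 : ℝ), f t = ∫ t in Set.Ioc 0 b, f t := fun f b hfb => by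
    refine setIntegral_eq_of_subset_of_forall_sdiff_eq_zero measurableSet_Ioi
      (hIoc le_rfl) fun t ht => hfb t ?_
    by_contra hlt
    exact ht.2 ⟨ht.1, by linarith⟩
  have hholder : ∀ N {a b : ℝ}, 0 ≤ a → a ≤ b → ∫ t in Set.Ioc a b, H N t ^ (1 / p) ≤
      (∫ t in Set.Ioc a b, H N t) ^ (1 / p) * (b - a) ^ θ := fun N a b ha hab => by
    have := integral_rpow_one_div_le (μ := volume.restrict (Set.Ioc a b)) hp (hintIoc N ha) (hH0 N)
    simpa [Measure.real, hab, hθdef] using this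
  have hJ : ∀ N, ∫ t in Set.Ioi (0 : ℝ), H N t ^ (1 / p) =
      ∫ t in Set.Ioc 0 (2 * S N), H N t ^ (1 / p) := fun N =>
    hres _ _ fun t ht => by rw [hsupp N t ht, Real.zero_rpow (by positivity)]
  have hS2 : ∀ N, S N ^ (-θ) * (2 * S N) ^ θ = 2 ^ θ := fun N => by
    rw [Real.mul_rpow two_pos.le (hS0 N).le, Real.rpow_neg (hS0 N).le]
    have := Real.rpow_pos_of_pos (hS0 N) θ
    field_simp
  -- Boundedness of `I`.
  obtain ⟨B, hB⟩ : ∃ B, ∀ N, I N ≤ B := by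
    refine ⟨(C * 2 ^ θ) ^ (1 / θ), fun M => ?_⟩
    obtain ⟨N, hN, hMN⟩ := (hle.and (eventually_ge_atTop M)).exists
    refine (hImono hMN).trans ?_
    have h1 : I N ≤ C * 2 ^ θ * I N ^ (1 / p) := by
      have h2 := hholder N le_rfl (mul_nonneg two_pos.le (hS0 N).le)
      rw [← hJ, ← hres _ _ (hsupp N), sub_zero] at h2
      calc I N ≤ C * S N ^ (-θ) * ∫ t in Set.Ioi (0 : ℝ), H N t ^ (1 / p) := by linarith
        _ ≤ C * S N ^ (-θ) * (I N ^ (1 / p) * (2 * S N) ^ θ) := by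
            have := Real.rpow_nonneg (hS0 N).le (-θ)
            gcongr
        _ = C * 2 ^ θ * I N ^ (1 / p) := by rw [← hS2 N]; ring
    rcases (hI0 N).eq_or_lt with h0 | h0
    · rw [← h0]; positivity
    · have h3 : I N ^ θ ≤ C * 2 ^ θ := by
        rw [hθdef, Real.rpow_sub h0, Real.rpow_one, div_le_iff₀ (Real.rpow_pos_of_pos h0 _)]
        exact h1
      calc I N = (I N ^ θ) ^ (1 / θ) := by
            rw [← Real.rpow_mul h0.le, mul_one_div_cancel hθ.ne', Real.rpow_one]
        _ ≤ _ := by gcongr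
  have hbdd : BddAbove (Set.range I) := ⟨B, by rintro _ ⟨N, rfl⟩; exact hB N⟩
  set L := ⨆ N, I N
  have hIL : ∀ N, I N ≤ L := fun N => le_ciSup hbdd N
  set δ : ℝ := (ε / (2 * (C * 2 ^ θ + 1))) ^ p with hδ
  have hC2 : 0 < C * 2 ^ θ + 1 := by positivity
  have hδ0 : 0 < δ := by positivity
  have hδε : C * 2 ^ θ * δ ^ (1 / p) ≤ ε / 2 := by
    rw [hδ, ← Real.rpow_mul (by positivity), mul_one_div_cancel hp0.ne', Real.rpow_one,
      ← div_div, mul_div_assoc', div_le_iff₀ hC2]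
    nlinarith
  obtain ⟨N₀, hN₀⟩ := exists_lt_of_lt_ciSup (show L - δ < L by linarith)
  set T := 2 * S N₀ with hT
  have hT0 : 0 ≤ T := by have := hS0 N₀; positivity
  have hlim : Tendsto (fun N => C * T ^ θ * L ^ (1 / p) * S N ^ (-θ)) atTop (𝓝 0) := by
    have := ((tendsto_rpow_neg_atTop hθ).comp hS).const_mul (C * T ^ θ * L ^ (1 / p))
    simpa using this
  obtain ⟨N, hN, hNN, hNS, hNε⟩ := (hle.and ((eventually_ge_atTop N₀).and
    ((hS.eventually_ge_atTop (S N₀)).and (hlim.eventually_lt_const (half_pos hε))))).exists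
  have hTS : T ≤ 2 * S N := by linarith
  have hsplit : ∀ f : ℝ → ℝ, IntegrableOn f (Set.Ioc 0 (2 * S N)) →
      ∫ t in Set.Ioc 0 (2 * S N), f t =
        (∫ t in Set.Ioc 0 T, f t) + ∫ t in Set.Ioc T (2 * S N), f t := fun f hf => by
    rw [← Set.Ioc_union_Ioc_eq_Ioc hT0 hTS] at hf ⊢
    exact setIntegral_union (Set.Ioc_disjoint_Ioc_of_le le_rfl) measurableSet_Ioc
      hf.left_of_union hf.right_of_union
  have htail : ∫ t in Set.Ioc T (2 * S N), H N t ≤ δ := by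
    have h1 := hsplit _ (hintIoc N le_rfl)
    rw [← hres _ _ (hsupp N)] at h1
    have h2 : I N₀ ≤ ∫ t in Set.Ioc 0 T, H N t := by
      simp only [hI]
      rw [hres _ _ (hsupp N₀)]
      exact setIntegral_mono_on (hintIoc N₀ le_rfl) (hintIoc N le_rfl) measurableSet_Ioc
        fun t ht => hmono t ht.1 hNN
    have h3 := hIL N
    simp only [hI] at h2 h3 hN₀
    linarith
  have hhead : ∫ t in Set.Ioc 0 T, H N t ≤ L :=
    (setIntegral_mono_set (hint N) (Eventually.of_forall fun t => hH0 N t)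
      (Eventually.of_forall (hIoc le_rfl))).trans (hIL N)
  have hJint : IntegrableOn (fun t => H N t ^ (1 / p)) (Set.Ioc 0 (2 * S N)) :=
    integrable_rpow_one_div hp (hintIoc N le_rfl) (hH0 N)
  have hSθ : 0 ≤ S N ^ (-θ) := Real.rpow_nonneg (hS0 N).le _
  have hpos : ∀ a b : ℝ, 0 ≤ ∫ t in Set.Ioc a b, H N t := fun a b =>
    integral_nonneg fun t => hH0 N t
  have h1 := hholder N le_rfl hT0
  have h2 := hholder N hT0 hTS
  rw [sub_zero] at h1
  have hfinal : C * S N ^ (-θ) * ∫ t in Set.Ioi (0 : ℝ), H N t ^ (1 / p) ≤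
      C * T ^ θ * L ^ (1 / p) * S N ^ (-θ) + C * 2 ^ θ * δ ^ (1 / p) := by
    rw [hJ, hsplit _ hJint]
    calc _ ≤ C * S N ^ (-θ) * (L ^ (1 / p) * T ^ θ + δ ^ (1 / p) * (2 * S N) ^ θ) := by
          gcongr
          · refine h1.trans ?_
            gcongr
            exact hpos _ _
          · refine h2.trans ?_
            gcongr
            · exact hpos _ _
            · linarith
      _ = C * T ^ θ * L ^ (1 / p) * S N ^ (-θ) +
            C * (S N ^ (-θ) * (2 * S N) ^ θ) * δ ^ (1 / p) := by ring
      _ = _ := by rw [hS2]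
  have := hI0 N
  simp only [hI] at this
  linarith

/-! ### Weighted integrals of elements of the weighted Lebesgue space -/

section Weighted

variable {n : ℕ}

lemma continuous_bracketPow_inv_smul (q R : ℝ) :
    Continuous fun x : EuclideanSpace ℝ (Fin n) => bracketPow q (R⁻¹ • x) :=
  (continuous_bracketPow q).comp (continuous_const_smul _)

lemma integrable_bracketPow_inv_smul {q R : ℝ} (hq : (n : ℝ) < q) (hR : 0 < R) :
    Integrable fun x : EuclideanSpace ℝ (Fin n) => bracketPow q (R⁻¹ • x) :=
  (integrable_bracketPow hq).comp_smul (inv_ne_zero hR.ne')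

lemma integral_bracketPow_inv_smul {q R : ℝ} (hR : 0 < R) :
    ∫ x : EuclideanSpace ℝ (Fin n), bracketPow q (R⁻¹ • x) =
      R ^ n * ∫ x : EuclideanSpace ℝ (Fin n), bracketPow q x := by
  rw [Measure.integral_comp_inv_smul volume (bracketPow q), finrank_euclideanSpace,
    Fintype.card_fin, abs_of_pos (by positivity), smul_eq_mul]

lemma bracketPow_inv_smul_mono {q R R' : ℝ} (hq : 0 ≤ q) (hR : 0 < R) (h : R ≤ R')
    (x : EuclideanSpace ℝ (Fin n)) : bracketPow q (R⁻¹ • x) ≤ bracketPow q (R'⁻¹ • x) := by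
  have := bracketPow_le_of_japanese_le hq one_pos (x := R'⁻¹ • x) (y := R⁻¹ • x)
    (japanese_le_of_norm_le le_rfl ?_)
  · simpa using this
  · rw [one_mul, norm_smul, norm_smul, norm_inv, norm_inv, Real.norm_of_nonneg hR.le,
      Real.norm_of_nonneg (hR.le.trans h)]
    gcongr

variable (n) in
/-- The measure `⟨x / R⟩^{-q} dx`. -/
def rescaledMeasure (q R : ℝ) : Measure (EuclideanSpace ℝ (Fin n)) :=
  volume.withDensity fun x => ENNReal.ofReal (bracketPow q (R⁻¹ • x))

lemma integral_rescaledMeasure (q R : ℝ) (g : EuclideanSpace ℝ (Fin n) → ℝ) :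
    ∫ x, g x ∂(rescaledMeasure n q R) = ∫ x, g x * bracketPow q (R⁻¹ • x) := by
  rw [rescaledMeasure, integral_withDensity_eq_integral_toReal_smul
    (continuous_bracketPow_inv_smul q R).measurable.ennreal_ofReal (by simp)]
  refine integral_congr_ae (Eventually.of_forall fun x => ?_)
  simp only [ENNReal.toReal_ofReal (bracketPow_pos q _).le, smul_eq_mul]
  ring

lemma integrable_rescaledMeasure_iff (q R : ℝ) (g : EuclideanSpace ℝ (Fin n) → ℝ) :
    Integrable g (rescaledMeasure n q R) ↔ Integrable fun x => g x * bracketPow q (R⁻¹ • x) := by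
  rw [rescaledMeasure, integrable_withDensity_iff_integrable_smul'
    (continuous_bracketPow_inv_smul q R).measurable.ennreal_ofReal (by simp)]
  refine integrable_congr (Eventually.of_forall fun x => ?_)
  simp only [ENNReal.toReal_ofReal (bracketPow_pos q _).le, smul_eq_mul]
  ring

lemma isFiniteMeasure_rescaledMeasure {q R : ℝ} (hq : (n : ℝ) < q) (hR : 0 < R) :
    IsFiniteMeasure (rescaledMeasure n q R) :=
  isFiniteMeasure_withDensity_ofReal (integrable_bracketPow_inv_smul hq hR).2

lemma real_rescaledMeasure_univ {q R : ℝ} (hR : 0 < R) :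
    (rescaledMeasure n q R).real Set.univ =
      R ^ n * ∫ x : EuclideanSpace ℝ (Fin n), bracketPow q x := by
  have := integral_rescaledMeasure (n := n) q R fun _ => 1
  rw [integral_const, smul_eq_mul, mul_one] at this
  simp only [one_mul] at this
  rw [this, integral_bracketPow_inv_smul hR]

lemma rescaledMeasure_le {q R : ℝ} (hq : 0 ≤ q) (hR : 1 ≤ R) :
    rescaledMeasure n q R ≤ ENNReal.ofReal (R ^ q) • weightedVolume n (-q) := by
  rw [rescaledMeasure, weightedVolume, ← withDensity_smul _ (by
    exact (continuous_bracketPow q).measurable.ennreal_ofReal)]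
  refine withDensity_mono (Eventually.of_forall fun x => ?_)
  simp only [Pi.smul_apply, smul_eq_mul]
  rw [← ENNReal.ofReal_mul (by positivity)]
  refine ENNReal.ofReal_le_ofReal (bracketPow_le_of_japanese_le hq (by linarith)
    (japanese_le_of_norm_le hR ?_))
  rw [norm_smul, norm_inv, Real.norm_of_nonneg (by linarith),
    mul_inv_cancel_left₀ (by linarith)]

/-- The weighted integral `∫ |w|^p ⟨x / R⟩^{-q} dx`. -/
def weightedPowIntegral {p q : ℝ} (R : ℝ) (w : WeightedLp n p (-q)) : ℝ :=
  ∫ x, |w x| ^ p * bracketPow q (R⁻¹ • x)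

variable {p q R : ℝ}

lemma weightedPowIntegral_nonneg (w : WeightedLp n p (-q)) : 0 ≤ weightedPowIntegral R w :=
  integral_nonneg fun x => mul_nonneg (by positivity) (bracketPow_pos q _).le

lemma memLp_rescaledMeasure (hq : 0 ≤ q) (hR : 1 ≤ R) (w : WeightedLp n p (-q)) :
    MemLp w (ENNReal.ofReal p) (rescaledMeasure n q R) :=
  (Lp.memLp w).of_measure_le_smul ENNReal.ofReal_ne_top (rescaledMeasure_le hq hR)

lemma integrable_abs_rpow_rescaledMeasure (hp : 1 < p) (hq : 0 ≤ q) (hR : 1 ≤ R)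
    (w : WeightedLp n p (-q)) : Integrable (fun x => |w x| ^ p) (rescaledMeasure n q R) := by
  have := (memLp_rescaledMeasure hq hR w).integrable_norm_rpow (by simpa using by linarith)
    ENNReal.ofReal_ne_top
  rwa [ENNReal.toReal_ofReal (by linarith)] at this

lemma weightedPowIntegral_mono (hp : 1 < p) (hq : 0 ≤ q) (w : WeightedLp n p (-q)) {R' : ℝ}
    (hR : 1 ≤ R) (h : R ≤ R') : weightedPowIntegral R w ≤ weightedPowIntegral R' w := by
  refine integral_mono ((integrable_rescaledMeasure_iff q R _).1
    (integrable_abs_rpow_rescaledMeasure hp hq hR w)) ((integrable_rescaledMeasure_iff q R' _).1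
    (integrable_abs_rpow_rescaledMeasure hp hq (hR.trans h) w)) fun x => ?_
  refine mul_le_mul_of_nonneg_left ?_ (by positivity)
  exact bracketPow_inv_smul_mono hq (by linarith) h x

/-- `w ↦ ∫ |w|^p ⟨x / R⟩^{-q} dx` is the `p`-th power of the norm of the image of `w` under a
continuous linear map. -/
lemma exists_weightedPowIntegral_eq [hp : Fact (1 < p)] (hq : 0 ≤ q) (hR : 1 ≤ R) :
    ∃ T : WeightedLp n p (-q) →L[ℝ] Lp ℝ (ENNReal.ofReal p) (rescaledMeasure n q R),
      ∀ w, weightedPowIntegral R w = ‖T w‖ ^ p := by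
  have hp1 := hp.out
  have hp0 : 0 < p := by linarith
  refine ⟨Lp.LpToLpOfMeasureLeSMul ENNReal.ofReal_ne_top (rescaledMeasure_le hq hR), fun w => ?_⟩
  have h1 := Lp.coeFn_LpToLpOfMeasureLeSMul (p := ENNReal.ofReal p) (E := ℝ)
    ENNReal.ofReal_ne_top (rescaledMeasure_le (n := n) hq hR) w
  have hpow : 0 ≤ ∫ x, |w x| ^ p ∂(rescaledMeasure n q R) := integral_nonneg fun x => by positivity
  rw [Lp.norm_def, eLpNorm_congr_ae h1, (memLp_rescaledMeasure hq hR w).eLpNorm_eq_integral_rpow_norm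
    (by simpa using hp0) ENNReal.ofReal_ne_top, ENNReal.toReal_ofReal hp0.le,
    ENNReal.toReal_ofReal (by simpa using Real.rpow_nonneg hpow _)]
  simp only [Real.norm_eq_abs]
  rw [← Real.rpow_mul hpow, inv_mul_cancel₀ hp0.ne', Real.rpow_one, integral_rescaledMeasure]
  rfl

/-- Hölder's inequality in space. -/
lemma integrable_and_integral_abs_mul_le (hp : 1 < p) (hq : (n : ℝ) < q) (hR : 1 ≤ R)
    (w : WeightedLp n p (-q)) :
    Integrable (fun x => |w x| * bracketPow q (R⁻¹ • x)) ∧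
    ∫ x, |w x| * bracketPow q (R⁻¹ • x) ≤ weightedPowIntegral R w ^ (1 / p) *
      (R ^ n * ∫ x : EuclideanSpace ℝ (Fin n), bracketPow q x) ^ (1 - 1 / p) := by
  have hq0 : 0 ≤ q := (Nat.cast_nonneg n).trans hq.le
  have hR0 : 0 < R := by linarith
  have hp0 : 0 < p := by linarith
  have := isFiniteMeasure_rescaledMeasure hq hR0
  have hpow : ∀ x, (|w x| ^ p) ^ (1 / p) = |w x| := fun x => by
    rw [← Real.rpow_mul (abs_nonneg _), mul_one_div_cancel hp0.ne', Real.rpow_one]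
  refine ⟨(integrable_rescaledMeasure_iff q R _).1 ((memLp_rescaledMeasure hq0 hR w).integrable
    (by simpa using hp.le)).abs, ?_⟩
  have h := integral_rpow_one_div_le hp (integrable_abs_rpow_rescaledMeasure hp hq0 hR w)
    fun x => by positivity
  simp only [hpow] at h
  rwa [integral_rescaledMeasure, integral_rescaledMeasure, real_rescaledMeasure_univ hR0] at h

/-- Integrability in time of the weighted spatial integrals. -/
lemma integrableOn_weightedPowIntegral [hp : Fact (1 < p)] (hq : 0 ≤ q) (hR : 1 ≤ R)
    {v : ℝ → WeightedLp n p (-q)} (hv : MemLpLoc p v) (T : ℝ) :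
    IntegrableOn (fun t => weightedPowIntegral R (v t)) (Set.Icc 0 T) := by
  have hp0 : 0 < p := one_pos.trans hp.out
  obtain ⟨L, hL⟩ := exists_weightedPowIntegral_eq (n := n) (p := p) hq hR
  have h := (L.comp_memLp' (hv T)).integrable_norm_rpow (by simpa using hp0) ENNReal.ofReal_ne_top
  rw [ENNReal.toReal_ofReal hp0.le] at h
  exact h.congr (Eventually.of_forall fun t => (hL (v t)).symm)

end Weighted

/-! ### The initial data in the weak formulation -/

section Data

variable {n : ℕ}

lemma tendsto_natCast_add_one : Tendsto (fun N : ℕ => (N : ℝ) + 1) atTop atTop :=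
  tendsto_atTop_add_const_right _ _ tendsto_natCast_atTop_atTop

lemma tendsto_integral_mul_bracketPow_inv_smul {q : ℝ} (hq : 0 ≤ q)
    {f : EuclideanSpace ℝ (Fin n) → ℝ} (hf : Integrable f) :
    Tendsto (fun N : ℕ => ∫ x, f x * bracketPow q (((N : ℝ) + 1)⁻¹ • x)) atTop
      (𝓝 (∫ x, f x)) := by
  refine tendsto_integral_of_dominated_convergence (fun x => |f x|)
    (fun N => hf.aestronglyMeasurable.mul (continuous_bracketPow_inv_smul q _).aestronglyMeasurable)
    hf.abs (fun N => Eventually.of_forall fun x => ?_) (Eventually.of_forall fun x => ?_)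
  · rw [Real.norm_eq_abs, abs_mul, abs_of_pos (bracketPow_pos q _)]
    exact mul_le_of_le_one_right (abs_nonneg _) (bracketPow_le_one hq _)
  · have h1 : Tendsto (fun N : ℕ => ((N : ℝ) + 1)⁻¹ • x) atTop (𝓝 0) := by
      simpa using (tendsto_inv_atTop_zero.comp tendsto_natCast_add_one).smul_const x
    have h2 := ((continuous_bracketPow q).tendsto 0).comp h1
    rw [bracketPow_zero_right] at h2
    simpa using h2.const_mul (f x)

lemma tendsto_integral_mul_fracLap_bracketPow_inv_smul [NeZero n] {s σ : ℝ} (hs : 0 < s)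
    (hσ : 0 < σ) (h : Int.fract σ = 0 ∨ s ≤ Int.fract σ)
    {f : EuclideanSpace ℝ (Fin n) → ℝ} (hf : Integrable f) (b : ℝ) :
    Tendsto (fun N : ℕ => ∫ x, f x *
      (b * fracLap σ (fun z => bracketPow ((n : ℝ) + 2 * s) (((N : ℝ) + 1)⁻¹ • z)) x)) atTop
      (𝓝 0) := by
  obtain ⟨C, hC, hb⟩ := exists_abs_fracLap_bracketPow_inv_smul_le (n := n) hs hσ.le h
  have hlim : Tendsto (fun N : ℕ => (∫ x, |f x|) * (|b| * C) * ((N : ℝ) + 1) ^ (-(2 * σ))) atTop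
      (𝓝 0) := by
    have := ((tendsto_rpow_neg_atTop (y := 2 * σ) (by linarith)).comp
      tendsto_natCast_add_one).const_mul ((∫ x, |f x|) * (|b| * C))
    simpa using this
  refine squeeze_zero_norm (fun N => ?_) hlim
  have hR : (0 : ℝ) < (N : ℝ) + 1 := by positivity
  have hint : Integrable fun x => |f x| * (|b| * C * ((N : ℝ) + 1) ^ (-(2 * σ))) :=
    hf.abs.mul_const _
  refine (norm_integral_le_of_norm_le hint (Eventually.of_forall fun x => ?_)).trans_eq ?_
  · rw [Real.norm_eq_abs, abs_mul, abs_mul, mul_assoc |b|]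
    gcongr
    refine (hb _ hR x).trans (mul_le_of_le_one_right (by positivity)
      (bracketPow_le_one (by positivity) _))
  · rw [integral_mul_const]
    ring

lemma integrable_of_integrable_weightedVolume {r : ℝ} (hr : 0 ≤ r)
    {f : EuclideanSpace ℝ (Fin n) → ℝ} (hf : Integrable f (weightedVolume n r)) :
    Integrable f := by
  refine hf.mono_measure ?_
  calc volume = (volume : Measure (EuclideanSpace ℝ (Fin n))).withDensity 1 :=
        withDensity_one.symm
    _ ≤ weightedVolume n r := withDensity_mono (Eventually.of_forall fun x => by
        simp only [Pi.one_apply]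
        rw [ENNReal.one_le_ofReal]
        exact Real.one_le_rpow (one_le_japanese x) hr)

end Data

/-! ### The test function method -/

section TestFunction

lemma scalingFn_le (m ℓ : ℕ) (a σ : ℕ → ℝ) (η : ℝ) {j : ℕ} (hj : j ≤ m) (haj : a j ≠ 0) :
    scalingFn m ℓ a σ η ≤ ((j : ℝ) - ℓ) * η + 2 * σ j := by
  refine csInf_le (Set.Finite.bddBelow (((Set.finite_Iic m).subset fun j hj => hj.1).image _))
    ⟨j, ⟨hj, haj⟩, rfl⟩

lemma exists_weak_time_derivative {X : Type*} [NormedAddCommGroup X] [NormedSpace ℝ X] {ℓ : ℕ}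
    {p : ℝ} {u : ℝ → X} (hu : MemSobolevLoc ℓ p u) :
    ∃ v, MemLpLoc p v ∧ IsWeakTimeDeriv ℓ u v := by
  rcases Nat.eq_zero_or_pos ℓ with rfl | h
  · exact ⟨u, hu.1, fun θ _ _ _ => by simp⟩
  · exact hu.2 ℓ h le_rfl

variable {n : ℕ} [NeZero n] {p s : ℝ} [hp : Fact (1 < p)]

/-- The contribution of one term `a_j (-Δ)^{σ_j} ∂_t^j` of the operator, tested against
`ψ(t / R^η) ⟨x / R⟩^{-q}`. Both test functions dominate their derivatives, and Hölder's inequality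
in space leaves only the time integral of a `1/p`-th power. -/
lemma exists_abs_term_le (hs : 0 < s) {v : ℝ → WeightedLp n p (-((n : ℝ) + 2 * s))}
    {ψ : ℝ → ℝ} (hψ : ContDiff ℝ ((⊤ : ℕ∞) : WithTop ℕ∞) ψ) (hψ0 : ∀ t, 0 ≤ ψ t)
    {σ η b : ℝ} (hσ : 0 ≤ σ) (h : Int.fract σ = 0 ∨ s ≤ Int.fract σ) {k : ℤ}
    (hk : ∃ C : ℝ, 0 ≤ C ∧ ∀ t, 0 ≤ t → |timeDeriv ψ k t| ≤ C * ψ t ^ (1 / p))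
    (hη : ((n : ℝ) + η) * (1 - 1 / p) ≤ k * η + 2 * σ) :
    ∃ C : ℝ, 0 ≤ C ∧ ∀ R : ℝ, 1 ≤ R →
      IntegrableOn (fun t => (ψ ((R ^ η)⁻¹ * t) * weightedPowIntegral R (v t)) ^ (1 / p))
        (Set.Ioi 0) →
      |∫ t in Set.Ioi (0 : ℝ), timeDeriv (fun t => ψ ((R ^ η)⁻¹ * t)) k t *
        ∫ x, v t x * (b * fracLap σ (fun z => bracketPow ((n : ℝ) + 2 * s) (R⁻¹ • z)) x)| ≤
      C * (R ^ η) ^ (-(1 - 1 / p)) * ∫ t in Set.Ioi (0 : ℝ),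
        (ψ ((R ^ η)⁻¹ * t) * weightedPowIntegral R (v t)) ^ (1 / p) := by
  have hq : (n : ℝ) < n + 2 * s := by linarith
  have hp1 := hp.out
  obtain ⟨C₁, hC₁, h₁⟩ := hk
  obtain ⟨C₂, hC₂, h₂⟩ := exists_abs_fracLap_bracketPow_inv_smul_le (n := n) hs hσ h
  set Φ : ℝ := ∫ x : EuclideanSpace ℝ (Fin n), bracketPow ((n : ℝ) + 2 * s) x
  have hΦ : 0 ≤ Φ := integral_nonneg fun x => (bracketPow_pos _ x).le
  set θ := 1 - 1 / p with hθ
  refine ⟨C₁ * (|b| * C₂ * Φ ^ θ), by positivity, fun R hR hint => ?_⟩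
  have hR0 : 0 < R := by linarith
  have hS : 0 < R ^ η := Real.rpow_pos_of_pos hR0 η
  set S := R ^ η with hSdef
  have hspace : ∀ t, |∫ x, v t x * (b * fracLap σ (fun z => bracketPow ((n : ℝ) + 2 * s) (R⁻¹ • z)) x)| ≤
      |b| * C₂ * Φ ^ θ * (R ^ (-(2 * σ)) * (R ^ n) ^ θ) *
        weightedPowIntegral R (v t) ^ (1 / p) := by
    intro t
    obtain ⟨hi, hle⟩ := integrable_and_integral_abs_mul_le hp1 hq hR (v t)
    have hRσ : 0 ≤ R ^ (-(2 * σ)) := Real.rpow_nonneg hR0.le _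
    calc _ ≤ ∫ x, |b| * C₂ * R ^ (-(2 * σ)) * (|v t x| * bracketPow ((n : ℝ) + 2 * s) (R⁻¹ • x)) := by
          rw [← Real.norm_eq_abs]
          refine norm_integral_le_of_norm_le (hi.const_mul _) (Eventually.of_forall fun x => ?_)
          rw [Real.norm_eq_abs, abs_mul, abs_mul]
          calc _ ≤ |v t x| * (|b| * (C₂ * R ^ (-(2 * σ)) * bracketPow ((n : ℝ) + 2 * s) (R⁻¹ • x))) := by
                gcongr
                exact h₂ R hR0 x
            _ = _ := by ring
      _ ≤ |b| * C₂ * R ^ (-(2 * σ)) *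
            (weightedPowIntegral R (v t) ^ (1 / p) * (R ^ n * Φ) ^ θ) := by
          rw [integral_const_mul]
          gcongr
      _ = _ := by
          rw [Real.mul_rpow (by positivity) hΦ]
          ring
  have hpow : S⁻¹ ^ k * (R ^ (-(2 * σ)) * (R ^ n) ^ θ) ≤ S ^ (-θ) := by
    have h3 : S⁻¹ ^ k = R ^ (-(k * η)) := by
      rw [hSdef, ← Real.rpow_neg hR0.le, ← Real.rpow_intCast, ← Real.rpow_mul hR0.le]
      congr 1; ring
    rw [h3, hSdef, ← Real.rpow_natCast R n, ← Real.rpow_mul hR0.le, ← Real.rpow_mul hR0.le,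
      ← Real.rpow_add hR0, ← Real.rpow_add hR0]
    refine Real.rpow_le_rpow_of_exponent_le hR ?_
    linarith
  rw [← Real.norm_eq_abs]
  refine (norm_integral_le_of_norm_le (hint.const_mul (C₁ * (|b| * C₂ * Φ ^ θ) * S ^ (-θ)))
    ((ae_restrict_mem measurableSet_Ioi).mono fun t ht => ?_)).trans_eq ?_
  · have ht0 : 0 < t := ht
    have hSt : 0 ≤ S⁻¹ * t := by positivity
    have hF := weightedPowIntegral_nonneg (R := R) (v t)
    rw [Real.norm_eq_abs, abs_mul, timeDeriv_comp_mul hψ (inv_pos.2 hS), abs_mul,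
      abs_of_pos (by positivity), Real.mul_rpow (hψ0 _) hF]
    have hψp : 0 ≤ ψ (S⁻¹ * t) ^ (1 / p) := Real.rpow_nonneg (hψ0 _) _
    have hFp : 0 ≤ weightedPowIntegral R (v t) ^ (1 / p) := Real.rpow_nonneg hF _
    calc _ ≤ S⁻¹ ^ k * (C₁ * ψ (S⁻¹ * t) ^ (1 / p)) *
          (|b| * C₂ * Φ ^ θ * (R ^ (-(2 * σ)) * (R ^ n) ^ θ) *
            weightedPowIntegral R (v t) ^ (1 / p)) := by
          gcongr
          · exact h₁ _ hSt
          · exact hspace t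
      _ = C₁ * (|b| * C₂ * Φ ^ θ) * (S⁻¹ ^ k * (R ^ (-(2 * σ)) * (R ^ n) ^ θ)) *
            (ψ (S⁻¹ * t) ^ (1 / p) * weightedPowIntegral R (v t) ^ (1 / p)) := by ring
      _ ≤ _ := by gcongr
  · rw [integral_const_mul]

variable {m ℓ : ℕ} {a σ : ℕ → ℝ} {data : ℕ → EuclideanSpace ℝ (Fin n) → ℝ}

lemma tendsto_data_sum (hs : 0 < s) (hσ0 : ∀ j ≤ m, 0 ≤ σ j)
    (hσ : ∀ j ≤ m, a j ≠ 0 → Int.fract (σ j) = 0 ∨ s ≤ Int.fract (σ j))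
    (hdata : ∀ j, ℓ ≤ j → j < m → Integrable (data j)) :
    Tendsto (fun N : ℕ => ∑ j ∈ Finset.Ico ℓ m, ∫ x, data j x * (a (j + 1) *
      fracLap (σ (j + 1)) (fun z => bracketPow ((n : ℝ) + 2 * s) (((N : ℝ) + 1)⁻¹ • z)) x)) atTop
      (𝓝 (∑ j ∈ signSet m ℓ a σ, a (j + 1) * ∫ x, data j x)) := by
  classical
  rw [signSet, Finset.sum_filter]
  refine tendsto_finsetSum _ fun j hj => ?_
  obtain ⟨hℓj, hjm⟩ := Finset.mem_Ico.1 hj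
  have hi := hdata j hℓj hjm
  by_cases haj : a (j + 1) = 0
  · simp [haj]
  by_cases h0 : σ (j + 1) = 0
  · have hlim := (tendsto_integral_mul_bracketPow_inv_smul (q := (n : ℝ) + 2 * s)
      (by positivity) hi).const_mul (a (j + 1))
    rw [if_pos ⟨h0, haj⟩]
    refine hlim.congr fun N => ?_
    rw [h0, fracLap_zero, ← integral_const_mul]
    refine integral_congr_ae (Eventually.of_forall fun x => ?_)
    simp only
    ring
  · rw [if_neg fun h => h0 h.1]
    exact tendsto_integral_mul_fracLap_bracketPow_inv_smul hs
      (lt_of_le_of_ne (hσ0 _ hjm) (Ne.symm h0)) (hσ _ hjm haj) hi _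

/-- A scaling `η` with `(n + η)(1 - 1/p) ≤ g(η)`, i.e. `p ≤ h(η)`, excludes global weak
solutions. -/
lemma false_of_le_scalingFn (ham : a m ≠ 0) (hσm : σ m = 0) (hs : 0 < s)
    (hσ0 : ∀ j ≤ m, 0 ≤ σ j)
    (hσ : ∀ j ≤ m, a j ≠ 0 → Int.fract (σ j) = 0 ∨ s ≤ Int.fract (σ j))
    (hdata : ∀ j, ℓ ≤ j → j < m → Integrable (data j))
    (hsign : 0 < ∑ j ∈ signSet m ℓ a σ, a (j + 1) * ∫ x, data j x)
    {u : ℝ → WeightedLp n p (-((n : ℝ) + 2 * s))}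
    (hu : IsGlobalWeakSolution m ℓ a σ s p data u) {η : ℝ} (hη0 : 0 ≤ η)
    (hη : ((n : ℝ) + η) * (1 - 1 / p) ≤ scalingFn m ℓ a σ η) : False := by
  have hp1 := hp.out
  have hp0 : 0 < p := by linarith
  have hn : (0 : ℝ) < n := by exact_mod_cast Nat.pos_of_ne_zero (NeZero.ne n)
  have hθ : 0 < 1 - 1 / p := by rw [sub_pos, div_lt_one hp0]; exact hp1
  set q : ℝ := (n : ℝ) + 2 * s with hqdef
  have hq : 0 ≤ q := by positivity
  -- As `g(0) ≤ 2σ_m = 0`, the condition forces `η > 0`, so that the time scale `R^η` tends to `∞`.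
  have hηpos : 0 < η := by
    refine lt_of_le_of_ne hη0 fun h0 => ?_
    have := scalingFn_le m ℓ a σ η le_rfl ham
    rw [hσm, ← h0] at this
    rw [← h0] at hη
    nlinarith
  obtain ⟨v, hv, huv⟩ := exists_weak_time_derivative hu.sobolev
  obtain ⟨ψ, hψ, hψanti, hψ0, hψ1, hψone, hψ2, hψK⟩ := exists_timeCutoff hp1 m
  set R : ℕ → ℝ := fun N => (N : ℝ) + 1 with hR
  have hR1 : ∀ N, 1 ≤ R N := fun N => by simp [hR]
  have hR0 : ∀ N, 0 < R N := fun N => by linarith [hR1 N]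
  set S : ℕ → ℝ := fun N => R N ^ η with hSdef
  have hS0 : ∀ N, 0 < S N := fun N => Real.rpow_pos_of_pos (hR0 N) η
  have hS1 : ∀ N, 1 ≤ S N := fun N => Real.one_le_rpow (hR1 N) hη0
  have hRmono : Monotone R := fun M N h => by simpa [hR] using h
  have hSmono : Monotone S := fun M N h =>
    Real.rpow_le_rpow (hR0 M).le (hRmono h) hη0
  have hStop : Tendsto S atTop atTop := (tendsto_rpow_atTop hηpos).comp tendsto_natCast_add_one
  set H : ℕ → ℝ → ℝ := fun N t => ψ ((S N)⁻¹ * t) * weightedPowIntegral (R N) (v t) with hH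
  have hH0 : ∀ N t, 0 ≤ H N t := fun N t => mul_nonneg (hψ0 _) (weightedPowIntegral_nonneg _)
  have hψz : ∀ N t, 2 * S N ≤ t → ψ ((S N)⁻¹ * t) = 0 := fun N t ht => hψ2 _ (by
    rw [inv_mul_eq_div, le_div_iff₀ (hS0 N)]; exact ht)
  have hsupp : ∀ N t, 2 * S N ≤ t → H N t = 0 := fun N t ht => by
    simp only [hH, hψz N t ht, zero_mul]
  have hmono : ∀ t, 0 < t → Monotone fun N => H N t := fun t ht M N hMN =>
    mul_le_mul (hψanti (by have := hSmono hMN; have := hS0 M; gcongr))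
      (weightedPowIntegral_mono hp1 hq _ (hR1 M) (hRmono hMN)) (weightedPowIntegral_nonneg _)
      (hψ0 _)
  have hintIcc : ∀ N, IntegrableOn (H N) (Set.Icc 0 (2 * S N)) := fun N => by
    refine (integrableOn_weightedPowIntegral hq (hR1 N) hv (2 * S N)).bdd_mul (c := 1)
      (by have := hψ.continuous; fun_prop) (Eventually.of_forall fun t => ?_)
    rw [Real.norm_of_nonneg (hψ0 _)]
    exact hψ1 _
  have hext : ∀ (N : ℕ) {f : ℝ → ℝ}, IntegrableOn f (Set.Icc 0 (2 * S N)) →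
      (∀ t, 2 * S N ≤ t → f t = 0) → IntegrableOn f (Set.Ioi 0) := fun N f hf hz =>
    hf.of_forall_sdiff_eq_zero measurableSet_Ioi fun t ht => hz t (by
      by_contra hlt
      exact ht.2 ⟨ht.1.le, by linarith⟩)
  have hint : ∀ N, IntegrableOn (H N) (Set.Ioi 0) := fun N => hext N (hintIcc N) (hsupp N)
  have hintp : ∀ N, IntegrableOn (fun t => H N t ^ (1 / p)) (Set.Ioi 0) := fun N =>
    hext N (integrable_rpow_one_div hp1 (hintIcc N) (hH0 N)) fun t ht => by
      rw [hsupp N t ht, Real.zero_rpow (by positivity)]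
  have htest : ∀ N, IsTimeTest fun t => ψ ((S N)⁻¹ * t) := fun N =>
    ⟨hψ.comp (contDiff_const.mul contDiff_id), ⟨2 * S N, hψz N⟩, by
      filter_upwards [nhdsWithin_le_nhds (Iio_mem_nhds (hS0 N))] with t ht
      exact hψone _ (by rw [inv_mul_eq_div, div_le_one (hS0 N)]; exact le_of_lt ht)⟩
  -- The bounds for the terms of the operator.
  have hterm : ∀ j ∈ Finset.range (m + 1), ∃ C : ℝ, 0 ≤ C ∧ ∀ N,
      |(-1 : ℝ) ^ ((j : ℤ) - (ℓ : ℤ)) * (∫ t in Set.Ioi (0 : ℝ),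
        timeDeriv (fun t => ψ ((S N)⁻¹ * t)) ((j : ℤ) - (ℓ : ℤ)) t * (∫ x, v t x *
          (a j * fracLap (σ j) (fun z => bracketPow q ((R N)⁻¹ • z)) x)))| ≤
      C * S N ^ (-(1 - 1 / p)) * ∫ t in Set.Ioi (0 : ℝ), H N t ^ (1 / p) := by
    intro j hj
    have hjm : j ≤ m := by simpa [Nat.lt_succ_iff] using hj
    by_cases haj : a j = 0
    · exact ⟨0, le_rfl, fun N => by simp [haj]⟩
    obtain ⟨C, hC, h⟩ := exists_abs_term_le (v := v) (b := a j) (η := η) hs hψ hψ0 (hσ0 j hjm)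
      (hσ j hjm haj) (hψK ((j : ℤ) - ℓ) (by omega)) (by
        push_cast
        exact hη.trans (scalingFn_le m ℓ a σ η hjm haj))
    refine ⟨C, hC, fun N => ?_⟩
    rw [abs_mul, abs_zpow, abs_neg, abs_one, one_zpow, one_mul]
    exact h (R N) (hR1 N) (hintp N)
  choose! C hC hCle using hterm
  refine false_of_integral_add_le (C := ∑ j ∈ Finset.range (m + 1), C j) hp1
    (Finset.sum_nonneg hC) (half_pos hsign) hStop hS0 hint hH0 hmono hsupp ?_
  filter_upwards [(tendsto_data_sum (data := data) hs hσ0 hσ hdata).eventually_const_lt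
    (half_lt_self hsign)] with N hN
  have heq := hu.equation v hv huv _ (htest N) _ (isTestFunction_bracketPow_inv_smul hs (hR1 N))
  have hsum := (Finset.abs_sum_le_sum_abs _ _).trans
    (Finset.sum_le_sum fun j hj => hCle j hj N)
  rw [← Finset.sum_mul, ← Finset.sum_mul] at hsum
  have habs := (le_abs_self _).trans hsum
  have hI : ∫ t in Set.Ioi (0 : ℝ), H N t = _ := heq
  rw [hI]
  linarith

end TestFunction

/-! ### The critical exponent -/

section Critical

variable {n m ℓ : ℕ} {a σ : ℕ → ℝ} {p : ℝ}

lemma continuous_scalingFn (ham : a m ≠ 0) : Continuous (scalingFn m ℓ a σ) := by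
  classical
  set F := (Finset.range (m + 1)).filter fun j => a j ≠ 0 with hF
  have hne : F.Nonempty := ⟨m, by simp [hF, ham]⟩
  have h : scalingFn m ℓ a σ =
      fun η => F.inf' hne fun j => ((j : ℝ) - ℓ) * η + 2 * σ j := by
    funext η
    rw [Finset.inf'_eq_csInf_image, scalingFn]
    congr 2
    ext j
    simp [hF]
  rw [h]
  exact Continuous.finset_inf'_apply hne fun j _ => by fun_prop

/-- If `g(η) < (n + η)(1 - 1/p)` for all `η ≥ 0`, then some `j ≤ ℓ` has `a_j ≠ 0`: otherwise
`g(η) ≥ η`. -/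
lemma exists_le_of_scalingFn_lt (hp : 1 < p) (ham : a m ≠ 0) (hσ : ∀ j ≤ m, 0 ≤ σ j)
    (h : ∀ η, 0 ≤ η → scalingFn m ℓ a σ η < ((n : ℝ) + η) * (1 - 1 / p)) :
    ∃ j ≤ m, j ≤ ℓ ∧ a j ≠ 0 := by
  by_contra! hno
  have hp0 : 0 < p := by linarith
  have hθ : 0 ≤ 1 - 1 / p := by rw [sub_nonneg, div_le_one hp0]; exact hp.le
  have hge : ∀ η, 0 ≤ η → η ≤ scalingFn m ℓ a σ η := by
    intro η hη
    refine le_csInf ⟨_, m, ⟨le_rfl, ham⟩, rfl⟩ ?_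
    rintro _ ⟨j, ⟨hjm, haj⟩, rfl⟩
    have hlt : ℓ + 1 ≤ j := by
      by_contra hj
      exact haj (hno j hjm (by omega))
    have hlt' : (ℓ : ℝ) + 1 ≤ j := by exact_mod_cast hlt
    have := hσ j hjm
    simp only
    nlinarith
  have hη0 : 0 ≤ (n : ℝ) * (1 - 1 / p) * p := by positivity
  have h1 := (hge _ hη0).trans_lt (h _ hη0)
  have h2 : ((n : ℝ) + n * (1 - 1 / p) * p) * (1 - 1 / p) = n * (1 - 1 / p) * p := by
    field_simp
    ring
  exact absurd h1 (by rw [h2]; exact lt_irrefl _)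

/-- The strict inequality `h(η) < p` at all finite `η` passes to the supremum over `[0, ∞]`: when
some `j ≤ ℓ` has `a_j ≠ 0`, the function `g` is bounded above, so that `g(η) / (n + η)` is small
for large `η` and attains its maximum over the remaining compact interval. -/
lemma critExp_lt (hn : 0 < n) (hp : 1 < p) (ham : a m ≠ 0) (hσ : ∀ j ≤ m, 0 ≤ σ j)
    (h : ∀ η, 0 ≤ η → scalingFn m ℓ a σ η < ((n : ℝ) + η) * (1 - 1 / p)) :
    critExp n m ℓ a σ < ENNReal.ofReal p := by
  have hp0 : 0 < p := by linarith
  have hn' : (0 : ℝ) < n := by exact_mod_cast hn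
  have hθ : 0 < 1 - 1 / p := by rw [sub_pos, div_lt_one hp0]; exact hp
  obtain ⟨j, hjm, hjℓ, haj⟩ := exists_le_of_scalingFn_lt hp ham hσ h
  have hjℓ' : (j : ℝ) ≤ ℓ := by exact_mod_cast hjℓ
  obtain ⟨ρ, hρ, hgρ⟩ : ∃ ρ < 1 - 1 / p,
      ∀ η, 0 ≤ η → scalingFn m ℓ a σ η ≤ ρ * ((n : ℝ) + η) := by
    set M := 2 * (2 * σ j) / (1 - 1 / p)
    have hcont : ContinuousOn (fun η => scalingFn m ℓ a σ η / ((n : ℝ) + η)) (Set.Icc 0 (max M 0)) :=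
      (continuous_scalingFn ham).continuousOn.div (by fun_prop)
        fun η hη => by have := hη.1; positivity
    obtain ⟨η₀, hη₀, hmax⟩ := isCompact_Icc.exists_isMaxOn
      (Set.nonempty_Icc.2 (le_max_right M 0)) hcont
    have hpos₀ : 0 < (n : ℝ) + η₀ := by have := hη₀.1; positivity
    refine ⟨max (scalingFn m ℓ a σ η₀ / ((n : ℝ) + η₀)) ((1 - 1 / p) / 2),
      max_lt ((div_lt_iff₀ hpos₀).2 (by rw [mul_comm]; exact h η₀ hη₀.1)) (half_lt_self hθ),
      fun η hη => ?_⟩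
    have hpos : 0 < (n : ℝ) + η := by positivity
    rw [← div_le_iff₀ hpos]
    rcases le_total η (max M 0) with hle | hle
    · exact (hmax ⟨hη, hle⟩).trans (le_max_left _ _)
    · refine le_trans ?_ (le_max_right _ _)
      rw [div_le_iff₀ hpos]
      have h1 := scalingFn_le m ℓ a σ η hjm haj
      have h2 : M ≤ η := (le_max_left _ _).trans hle
      rw [div_le_iff₀ hθ] at h2
      nlinarith
  have hρ1 : 0 < 1 - ρ := by
    have : 0 < 1 / p := by positivity
    linarith
  have hfin : ∀ η, 0 ≤ η → hFin n m ℓ a σ η ≤ ENNReal.ofReal (1 / (1 - ρ)) := by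
    intro η hη
    refine ENNReal.div_le_of_le_mul ?_
    rw [← ENNReal.ofReal_mul (by positivity)]
    refine ENNReal.ofReal_le_ofReal ?_
    rw [div_mul_eq_mul_div, one_mul, le_div_iff₀ hρ1]
    have := hgρ η hη
    linarith
  have hext : critExp n m ℓ a σ ≤ ENNReal.ofReal (1 / (1 - ρ)) := by
    refine iSup_le fun η => ?_
    unfold hExt
    split_ifs with hη
    · refine limsup_le_of_le (by isBoundedDefault) ?_
      filter_upwards [eventually_ge_atTop 0] with η hη using hfin η hη
    · exact hfin _ ENNReal.toReal_nonneg
  refine hext.trans_lt ((ENNReal.ofReal_lt_ofReal_iff hp0).2 ?_)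
  rw [div_lt_iff₀ hρ1]
  have : p * (1 / p) = 1 := mul_one_div_cancel hp0.ne'
  nlinarith

end Critical

end FracEvolution

end

open FracEvolution in
theorem theorem1p2
    (n : ℕ) [NeZero n] (m ℓ : ℕ) (hℓ : ℓ < m)
    (a σ : ℕ → ℝ) (ha : a m = 1) (hσm : σ m = 0) (hσ : ∀ j < m, 0 ≤ σ j)
    (s : ℝ)
    (hs : IsLeast {r : ℝ | ∃ j < m, a j ≠ 0 ∧ Int.fract (σ j) ≠ 0 ∧ r = Int.fract (σ j)} s)
    (p : ℝ) [Fact (1 < p)]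
    (data : ℕ → EuclideanSpace ℝ (Fin n) → ℝ)
    (hdata_zero : ∀ j < ℓ, data j =ᵐ[volume] 0)
    (hdata_weight : ∀ j, ℓ ≤ j → j < m → j ∉ signSet m ℓ a σ →
      Integrable (data j) (weightedVolume n ((n : ℝ) + 2 * s)))
    (hdata_L1 : ∀ j ∈ signSet m ℓ a σ, Integrable (data j) volume)
    (hsign : 0 < ∑ j ∈ signSet m ℓ a σ, a (j + 1) * ∫ x, data j x)
    (u : ℝ → WeightedLp n p (-((n : ℝ) + 2 * s)))
    (hu : IsGlobalWeakSolution m ℓ a σ s p data u) :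
    critExp n m ℓ a σ < ENNReal.ofReal p := by
  have ham : a m ≠ 0 := by rw [ha]; exact one_ne_zero
  have hs0 : 0 < s := by
    obtain ⟨j, -, -, hj, rfl⟩ := hs.1
    exact lt_of_le_of_ne (Int.fract_nonneg _) (Ne.symm hj)
  have hσ0 : ∀ j ≤ m, 0 ≤ σ j := fun j hj => by
    rcases hj.eq_or_lt with rfl | hj
    · exact hσm.ge
    · exact hσ j hj
  have hσs : ∀ j ≤ m, a j ≠ 0 → Int.fract (σ j) = 0 ∨ s ≤ Int.fract (σ j) := fun j hj haj => by
    rcases hj.eq_or_lt with rfl | hj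
    · left; rw [hσm, Int.fract_zero]
    · by_cases h0 : Int.fract (σ j) = 0
      · exact Or.inl h0
      · exact Or.inr (hs.2 ⟨j, hj, haj, h0, rfl⟩)
  have hdata : ∀ j, ℓ ≤ j → j < m → Integrable (data j) := fun j hℓj hjm => by
    by_cases hj : j ∈ signSet m ℓ a σ
    · exact hdata_L1 j hj
    · exact integrable_of_integrable_weightedVolume (by positivity) (hdata_weight j hℓj hjm hj)
  refine critExp_lt (Nat.pos_of_ne_zero (NeZero.ne n)) (Fact.out : 1 < p) ham hσ0 fun η hη => ?_
  by_contra hle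
  exact false_of_le_scalingFn ham hσm hs0 hσ0 hσs hdata hsign hu hη (not_lt.1 hle)
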